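/- Let $(\overline M, ds^2)$ be the unit sphere $S^2$ (constant curvature $+1$) or the hyperbolic plane $\mathbb H^2$ (constant curvature $-1$), let $p\in\overline M$, let $0<R<\operatorname{inj}(\overline M)$, where $\operatorname{inj}(\overline M)$ is the injectivity radius, and let $B(R)=\{x : d(p,x)<R\}$ be the geodesic ball of radius $R$ centered at $p$. Consider the Steklov problem on $B(R)$: find $\nu\in\mathbb R$ and a function $f\not\equiv 0$, of class $C^2$ in $B(R)$ and of class $C^1$ on its closure, with $$\Delta f=0 \ \text{ in } B(R), \qquad \frac{\partial f}{\partial\eta}=\nu f \ \text{ on } \partial B(R),$$ where $\Delta$ is the Laplace–Beltrami operator and $\eta$ is the outward unit normal of $\partial B(R)$. Let $\nu_1(B(R))$ be the first nonzero Steklov eigenvalue, that is, the smallest nonzero $\nu$ for which such an $f$ exists. Then: 1. if $\overline M=S^2$, then $\nu_1(B(R))=\dfrac{1}{\sin R}$; 2. if $\overline M=\mathbb H^2$, then $\nu_1(B(R))=\dfrac{1}{\sinh R}$. -/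

import Mathlib

open Set Filter Topology Manifold
open scoped ContDiff ENNReal UpperHalfPlane

noncomputable section

namespace Steklov

section General

variable {E : Type*} [NormedAddCommGroup E] [NormedSpace ℝ E]
  {M : Type*} [TopologicalSpace M] [ChartedSpace E M]

/-- Riemannian metrics on the manifold `M`: a scalar product on every tangent space. -/
abbrev RMetric (E M : Type*) [NormedAddCommGroup E] [NormedSpace ℝ E]
    [TopologicalSpace M] [ChartedSpace E M] : Type _ :=
  Bundle.RiemannianMetric (fun x : M => TangentSpace 𝓘(ℝ, E) x)

/-- The matrix `(g_ij)` of the metric `g` in the chart of `M` around `x`, at the point of `M` with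
coordinate vector `y`. The coordinates are those with respect to a basis `b` of the model space. -/
def gramMatrix {ι : Type*} (g : RMetric E M) (b : Module.Basis ι ℝ E) (x : M) (y : E) :
    Matrix ι ι ℝ :=
  Matrix.of fun i j =>
    g.inner ((chartAt E x).symm y)
      (mfderiv 𝓘(ℝ, E) 𝓘(ℝ, E) (chartAt E x).symm y (b i))
      (mfderiv 𝓘(ℝ, E) 𝓘(ℝ, E) (chartAt E x).symm y (b j))

/-- The Laplace–Beltrami operator of `g`, computed at `x` in the chart of `M` around `x`:
`Δ f = (det g)^(-1/2) ∑ i, ∂_i (∑ j, (det g)^(1/2) g^ij ∂_j f)`. -/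
def laplaceBeltrami {ι : Type*} [Fintype ι] [DecidableEq ι] (g : RMetric E M)
    (b : Module.Basis ι ℝ E) (f : M → ℝ) (x : M) : ℝ :=
  (Real.sqrt (gramMatrix g b x (chartAt E x x)).det)⁻¹ *
    ∑ i, fderiv ℝ
      (fun y : E => ∑ j, Real.sqrt (gramMatrix g b x y).det * (gramMatrix g b x y)⁻¹ i j *
        fderiv ℝ (f ∘ (chartAt E x).symm) y (b j))
      (chartAt E x x) (b i)

/-- `η` is the outward unit normal of `Ω` at the boundary point `x`: it is a unit vector that makes
an angle of at least `π / 2` with the initial velocity of every curve that starts at `x` and stays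
in the closure of `Ω` for a short time. -/
def IsOutwardUnitNormal (g : RMetric E M) (Ω : Set M) (x : M) (η : TangentSpace 𝓘(ℝ, E) x) : Prop :=
  g.inner x η η = 1 ∧
    ∀ (c : ℝ → M) (h : c 0 = x), MDifferentiableAt 𝓘(ℝ, ℝ) 𝓘(ℝ, E) c 0 →
      (∀ᶠ t in 𝓝[≥] (0 : ℝ), c t ∈ closure Ω) →
      g.inner x η (h ▸ (mfderiv 𝓘(ℝ, ℝ) 𝓘(ℝ, E) c 0 (1 : ℝ) : TangentSpace 𝓘(ℝ, E) (c 0))) ≤ 0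

/-- `f` is a nonzero classical solution of the Steklov problem with parameter `ν` on the domain `Ω`:
`Δ f = 0` in `Ω` and `∂f/∂η = ν f` on the boundary of `Ω`. -/
structure IsSteklovEigenfunction {ι : Type*} [Fintype ι] [DecidableEq ι] (g : RMetric E M)
    (b : Module.Basis ι ℝ E) (Ω : Set M) (ν : ℝ) (f : M → ℝ) : Prop where
  contMDiffOn : ContMDiffOn 𝓘(ℝ, E) 𝓘(ℝ, ℝ) 2 f Ω
  contMDiffOn_closure : ContMDiffOn 𝓘(ℝ, E) 𝓘(ℝ, ℝ) 1 f (closure Ω)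
  ne_zero : ∃ x ∈ Ω, f x ≠ 0
  harmonic : ∀ x ∈ Ω, laplaceBeltrami g b f x = 0
  boundary : ∀ x ∈ frontier Ω, ∀ η : TangentSpace 𝓘(ℝ, E) x, IsOutwardUnitNormal g Ω x η →
    mvfderivWithin 𝓘(ℝ, E) f (closure Ω) x η = ν * f x

/-- `ν` is a Steklov eigenvalue of `Ω`. -/
def IsSteklovEigenvalue {ι : Type*} [Fintype ι] [DecidableEq ι] (g : RMetric E M)
    (b : Module.Basis ι ℝ E) (Ω : Set M) (ν : ℝ) : Prop :=
  ∃ f : M → ℝ, IsSteklovEigenfunction g b Ω ν f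

/-- `ν` is the first nonzero Steklov eigenvalue of `Ω`. -/
def IsFirstNonzeroSteklovEigenvalue {ι : Type*} [Fintype ι] [DecidableEq ι] (g : RMetric E M)
    (b : Module.Basis ι ℝ E) (Ω : Set M) (ν : ℝ) : Prop :=
  IsLeast {μ : ℝ | μ ≠ 0 ∧ IsSteklovEigenvalue g b Ω μ} ν

end General

section Distance

variable {M : Type*}

/-- The open ball of radius `R` around `p` for the distance function `d`. -/
def geodesicBall (d : M → M → ℝ) (p : M) (R : ℝ) : Set M := {x | d p x < R}

/-- Unit speed geodesics of a complete Riemannian manifold with Riemannian distance `d`: the curves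
that locally realize the distance and are parametrized by arc length. -/
def IsUnitSpeedGeodesic (d : M → M → ℝ) (γ : ℝ → M) : Prop :=
  ∀ t : ℝ, ∃ ε > 0, ∀ s ∈ Ioo (t - ε) (t + ε), ∀ s' ∈ Ioo (t - ε) (t + ε), d (γ s) (γ s') = |s - s'|

/-- The time (possibly `∞`) up to which the geodesic `γ` realizes the distance to `γ 0`, that is,
the distance from `γ 0` to its cut point along `γ`. -/
def cutTime (d : M → M → ℝ) (γ : ℝ → M) : ℝ≥0∞ :=
  ⨆ (t : ℝ) (_ : d (γ 0) (γ t) = t), ENNReal.ofReal t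

/-- The injectivity radius of a complete Riemannian manifold with Riemannian distance `d`: the
infimum over all points of the distance to the cut locus. -/
def injectivityRadius (d : M → M → ℝ) : ℝ≥0∞ :=
  ⨅ (γ : ℝ → M) (_ : IsUnitSpeedGeodesic d γ), cutTime d γ

end Distance

section Pullback

variable {E : Type*} [NormedAddCommGroup E] [NormedSpace ℝ E] [FiniteDimensional ℝ E]
  {M : Type*} [TopologicalSpace M] [ChartedSpace E M]
  {F : Type*} [NormedAddCommGroup F] [InnerProductSpace ℝ F]

/-- The metric `a · j^*⟨·,·⟩` on `M`, for `j : M → F` with injective differentials and a positive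
function `a` on `M`: `g_x(v, w) = a x * ⟪dj_x v, dj_x w⟫`. -/
def conformalPullback (j : M → F) (a : M → ℝ) (ha : ∀ x, 0 < a x)
    (hj : ∀ x, Function.Injective (mvfderiv 𝓘(ℝ, E) j x)) : RMetric E M where
  inner x :=
    let D : E →L[ℝ] F := mvfderiv 𝓘(ℝ, E) j x
    a x • ((innerSL ℝ (E := F)).bilinearComp D D : E →L[ℝ] E →L[ℝ] ℝ)
  symm x v w := by
    change a x * inner ℝ (mvfderiv 𝓘(ℝ, E) j x v) (mvfderiv 𝓘(ℝ, E) j x w) =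
      a x * inner ℝ (mvfderiv 𝓘(ℝ, E) j x w) (mvfderiv 𝓘(ℝ, E) j x v)
    rw [real_inner_comm]
  pos x v hv := by
    have h : mvfderiv 𝓘(ℝ, E) j x v ≠ 0 := fun h0 => hv (hj x (by rw [h0, map_zero]))
    exact mul_pos (ha x) (real_inner_self_pos.2 h)
  continuousAt x := by
    have : Continuous fun v : TangentSpace 𝓘(ℝ, E) x =>
        a x * inner ℝ (mvfderiv 𝓘(ℝ, E) j x v) (mvfderiv 𝓘(ℝ, E) j x v) := by fun_prop
    exact this.continuousAt
  isVonNBounded x := by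
    let D : E →L[ℝ] F := mvfderiv 𝓘(ℝ, E) j x
    have hD : Function.Injective D := hj x
    obtain ⟨K, hK, hKD⟩ := D.toLinearMap.exists_antilipschitzWith (LinearMap.ker_eq_bot.2 hD)
    have hb : Bornology.IsBounded {v : E | a x * inner ℝ (D v) (D v) < 1} := by
      refine (Metric.isBounded_closedBall (x := (0 : E)) (r := K * Real.sqrt (a x)⁻¹)).subset ?_
      intro v hv
      have h1 : ‖v‖ ≤ K * ‖D v‖ := by
        simpa using hKD.le_mul_norm (map_zero D.toLinearMap) v
      have h2 : ‖D v‖ ≤ Real.sqrt (a x)⁻¹ := by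
        apply Real.le_sqrt_of_sq_le
        have hv' : a x * inner ℝ (D v) (D v) < 1 := hv
        rw [real_inner_self_eq_norm_sq] at hv'
        rw [← one_div, le_div_iff₀ (ha x)]
        linarith
      rw [mem_closedBall_zero_iff]
      exact h1.trans (by gcongr)
    exact (NormedSpace.isVonNBounded_iff ℝ (E := E)).2 hb

end Pullback

/-- The unit sphere of `ℝ³`. -/
abbrev S2 : Type := Metric.sphere (0 : EuclideanSpace ℝ (Fin 3)) 1

/-- The metric of curvature `1` on the unit sphere, induced by the inclusion into `ℝ³`. -/
def sphereMetric : RMetric (EuclideanSpace ℝ (Fin 2)) S2 :=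
  conformalPullback (fun x => (x : EuclideanSpace ℝ (Fin 3))) (fun _ => 1) (fun _ => one_pos)
    fun x =>
      haveI : Fact (Module.finrank ℝ (EuclideanSpace ℝ (Fin 3)) = 2 + 1) :=
        ⟨finrank_euclideanSpace_fin⟩
      injective_mvfderiv_subtypeVal_sphere x

/-- The Riemannian distance of the unit sphere: the angle between `x` and `y`. -/
def sphereDist (x y : S2) : ℝ :=
  InnerProductGeometry.angle (x : EuclideanSpace ℝ (Fin 3)) (y : EuclideanSpace ℝ (Fin 3))

theorem injective_mvfderiv_coe_upperHalfPlane (z : ℍ) :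
    Function.Injective (mvfderiv 𝓘(ℝ, ℂ) (fun w : ℍ => (w : ℂ)) z) := by
  have : IsManifold 𝓘(ℝ, ℂ) 1 ℍ := UpperHalfPlane.isOpenEmbedding_coe.isManifold_singleton
  have h : ContMDiff 𝓘(ℝ, ℂ) 𝓘(ℝ, ℂ) 1 (fun w : ℍ => (w : ℂ)) := fun _ => contMDiffAt_extChartAt
  have h2 : (writtenInExtChartAt 𝓘(ℝ, ℂ) 𝓘(ℝ, ℂ) z fun w : ℍ => (w : ℂ)) =ᶠ[𝓝 (z : ℂ)] id := by
    filter_upwards [UpperHalfPlane.isOpen_upperHalfPlaneSet.mem_nhds z.im_pos] with w hw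
    refine (chartAt ℂ z).right_inv (x := w) ?_
    have : w ∈ range UpperHalfPlane.coe := ⟨⟨w, hw⟩, rfl⟩
    simpa [chartAt, ChartedSpace.chartAt] using! this
  rw [(h.mdifferentiable one_ne_zero z).mvfderiv]
  simp only [modelWithCornersSelf_coe, range_id, fderivWithin_univ]
  have h3 := h2.fderiv_eq (𝕜 := ℝ)
  rw [fderiv_id] at h3
  intro v w hvw
  exact (DFunLike.congr_fun h3 v).symm.trans (hvw.trans (DFunLike.congr_fun h3 w))

/-- The metric `(dx² + dy²) / y²` of curvature `-1` on the upper half-plane. -/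
def hyperbolicMetric : RMetric ℂ ℍ :=
  conformalPullback (fun z => (z : ℂ)) (fun z => (z.im ^ 2)⁻¹)
    (fun z => inv_pos.2 (pow_pos z.im_pos 2)) injective_mvfderiv_coe_upperHalfPlane

end Steklov

end

/-!
On a surface the Laplacian is conformally covariant: in a conformal coordinate with values in `ℂ`
the equation `Δ f = 0` is the flat Laplace equation. Both geodesic balls have a conformal coordinate
that maps them onto a Euclidean disc of radius `ρ` around `0` and whose conformal factor takes a
constant value `s` on the bounding circle: stereographic projection from the antipode of the centre
for the sphere (`isConformalDisc_sphere`), the Cayley transform that sends the centre to `0` for the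
hyperbolic plane (`isConformalDisc_upperHalfPlane`). There the outward unit normal is `(ρ s)⁻¹`
times the radial vector `z`, so that the boundary condition `∂f/∂η = ν f` reads `z · ∇F = k F` with
`k = ν ρ s`. The number `ρ s` is `sin R` for the sphere and `sinh R` for the hyperbolic plane, and
the claim becomes that `1` is the smallest nonzero value of `k` for the flat disc.

It is attained by the real part of the coordinate. Conversely, let `F` be a solution. The function
`z · ∇F - k F` is harmonic in the disc, is continuous up to the boundary and vanishes there, so by
the Poisson formula it vanishes everywhere (`fderiv_apply_self_eq_of_harmonic`). By Euler's identity
`F` is then homogeneous of degree `k`; as it is differentiable at `0` and not zero, `k ≠ 0` forces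
`1 ≤ k` (`one_le_of_radial_derivative_eq`).

The covariance of the Laplacian (`laplacian_comp_of_conformal`) holds because the differential of a
conformal map carries an orthonormal basis to a multiple of one, and a conformal map between planes
is itself harmonic. `IsConformalDisc.isFirstNonzeroSteklovEigenvalue` assembles these facts for an
abstract surface; the bound `R < π` that the sphere needs comes from the injectivity radius, which a
great circle bounds by `π`.
-/

namespace Steklov

open Metric InnerProductSpace

/-! ### Euler's identity on a disc -/

section Disc

variable {F : ℂ → ℝ} {ρ k : ℝ}

theorem uniqueDiffOn_closedBall_complex (hρ : 0 < ρ) : UniqueDiffOn ℝ (closedBall (0 : ℂ) ρ) :=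
  uniqueDiffOn_convex (convex_closedBall _ _) (by simp [interior_closedBall _ hρ.ne', hρ])

/-- A function `F` that is harmonic in a disc, `C^1` up to the boundary, and satisfies Euler's
identity `z · ∇F = k F` on the boundary circle satisfies it in the whole disc: the difference of the
two sides is harmonic in the disc and continuous up to the boundary, where it vanishes. -/
theorem fderiv_apply_self_eq_of_harmonic (hρ : 0 < ρ)
    (hF : ContDiffOn ℝ 1 F (closedBall 0 ρ)) (hh : HarmonicOnNhd F (ball 0 ρ))
    (hb : ∀ z : ℂ, ‖z‖ = ρ → fderivWithin ℝ F (closedBall 0 ρ) z z = k * F z)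
    {z : ℂ} (hz : z ∈ ball (0 : ℂ) ρ) : fderiv ℝ F z z = k * F z := by
  -- Writing `F` as the real part of a holomorphic function shows that the defect is harmonic,
  -- although `F` is only assumed to be `C^2`.
  obtain ⟨g, hg, hgF⟩ := hh.exists_analyticOnNhd_ball_re_eq
  set w : ℂ → ℝ := fun z => fderivWithin ℝ F (closedBall 0 ρ) z z - k * F z with hw
  have hfd : ∀ z ∈ ball (0 : ℂ) ρ, fderivWithin ℝ F (closedBall 0 ρ) z = fderiv ℝ F z := fun z hz =>
    fderivWithin_of_mem_nhds (mem_of_superset (isOpen_ball.mem_nhds hz) ball_subset_closedBall)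
  have hcont : ContinuousOn w (closedBall 0 ρ) :=
    ((hF.continuousOn_fderivWithin (uniqueDiffOn_closedBall_complex hρ) le_rfl).clm_apply
      continuousOn_id).sub (continuousOn_const.mul hF.continuousOn)
  have hre : ∀ z ∈ ball (0 : ℂ) ρ, w z = (z * deriv g z - k * g z).re := by
    intro z hz
    have h1 : F =ᶠ[𝓝 z] fun y => (g y).re := by
      filter_upwards [isOpen_ball.mem_nhds hz] with y hy using (hgF hy).symm
    have h2 : HasFDerivAt (fun y => (g y).re)
        (Complex.reCLM.comp (deriv g z • (1 : ℂ →L[ℝ] ℂ))) z :=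
      Complex.reCLM.hasFDerivAt.comp z (hg z hz).differentiableAt.hasDerivAt.complexToReal_fderiv
    have h3 : F z = (g z).re := (hgF hz).symm
    simp only [hw, hfd z hz, (h2.congr_of_eventuallyEq h1).fderiv, h3]
    simp [mul_comm]
  have hharm : HarmonicOnNhd w (ball 0 ρ) := by
    intro z hz
    have h1 : w =ᶠ[𝓝 z] fun y => (y * deriv g y - k * g y).re := by
      filter_upwards [isOpen_ball.mem_nhds hz] with y hy using hre y hy
    rw [harmonicAt_congr_nhds h1]
    refine AnalyticAt.harmonicAt_re (f := fun y => y * deriv g y - k * g y) ?_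
    exact (analyticAt_id.mul (hg z hz).deriv).sub (analyticAt_const.mul (hg z hz))
  have hp := (HarmonicContOnCl.mk_ball hharm hcont).circleAverage_poissonKernel_smul hz
  rw [Real.circleAverage_congr_sphere (f₂ := fun _ => (0 : ℝ)), Real.circleAverage_const] at hp
  · rw [← hfd z hz]
    simp only [hw] at hp
    linarith
  · intro y hy
    rw [abs_of_pos hρ, mem_sphere_zero_iff_norm] at hy
    simp [hw, hb y hy]

/-- A function on a disc that is harmonic inside and `C^1` up to the boundary, with radial
derivative a multiple of the function on the boundary, is homogeneous; being differentiable at the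
centre, it has degree at least `1` if the degree is not `0`. -/
theorem one_le_of_radial_derivative_eq (hρ : 0 < ρ)
    (hF : ContDiffOn ℝ 1 F (closedBall 0 ρ)) (hh : HarmonicOnNhd F (ball 0 ρ))
    (hb : ∀ z : ℂ, ‖z‖ = ρ → fderivWithin ℝ F (closedBall 0 ρ) z z = k * F z)
    (hne : ∃ z ∈ ball (0 : ℂ) ρ, F z ≠ 0) (hk : k ≠ 0) : 1 ≤ k := by
  have euler := fun z hz => fderiv_apply_self_eq_of_harmonic (z := z) hρ hF hh hb hz
  have hF0 : F 0 = 0 := by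
    have := euler 0 (mem_ball_self hρ)
    simpa [hk] using this
  by_contra! hk1
  obtain ⟨z, hz, hFz⟩ := hne
  have hdiff : ∀ y ∈ ball (0 : ℂ) ρ, DifferentiableAt ℝ F y := fun y hy =>
    (hh y hy).1.differentiableAt two_ne_zero
  have hmem : ∀ t ∈ Icc (0 : ℝ) 1, (t : ℂ) * z ∈ ball (0 : ℂ) ρ := by
    intro t ht
    rw [mem_ball_zero_iff] at hz ⊢
    rw [norm_mul, Complex.norm_real, Real.norm_of_nonneg ht.1]
    nlinarith [norm_nonneg z, ht.2]
  have hder : ∀ t ∈ Icc (0 : ℝ) 1,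
      HasDerivAt (fun t : ℝ => F (t * z)) (fderiv ℝ F (t * z) z) t := by
    intro t ht
    have h1 : HasDerivAt (fun t : ℝ => (t : ℂ) * z) z t := by
      simpa using (Complex.ofRealCLM.hasDerivAt (x := t)).mul_const z
    exact (hdiff _ (hmem t ht)).hasFDerivAt.comp_hasDerivAt t h1
  -- By Euler's identity `t ^ (-k) * F (t z)` is constant along the radius.
  have hconst : ∀ t ∈ Ioc (0 : ℝ) 1, F z = t ^ (-k) * F (t * z) := by
    intro t ht
    have hd : ∀ s ∈ Icc t 1, HasDerivAt (fun s : ℝ => s ^ (-k) * F (s * z)) 0 s := by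
      intro s hs
      have hs0 : 0 < s := ht.1.trans_le hs.1
      have h1 := (Real.hasDerivAt_rpow_const (p := -k) (Or.inl hs0.ne')).mul
        (hder s ⟨hs0.le, hs.2⟩)
      convert! h1 using 1
      have h2 := euler _ (hmem s ⟨hs0.le, hs.2⟩)
      have h3 : fderiv ℝ F (s * z) (s * z) = s * fderiv ℝ F (s * z) z := by
        rw [← Complex.real_smul, map_smul, smul_eq_mul]
      rw [h3] at h2
      have h4 : s ^ (-k) = s ^ (-k - 1) * s := by
        rw [Real.rpow_sub_one hs0.ne']; field_simp
      rw [h4]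
      linear_combination -(s ^ (-k - 1)) * h2
    have := constant_of_has_deriv_right_zero
      (fun s hs => (hd s hs).continuousAt.continuousWithinAt)
      (fun s hs => (hd s (Ico_subset_Icc_self hs)).hasDerivWithinAt) 1 (right_mem_Icc.2 ht.2)
    simpa using this
  -- Since `F 0 = 0`, homogeneity writes `F z` as `t ^ (1 - k)` times a difference quotient.
  have hlim : Tendsto (fun t : ℝ => t ^ (1 - k) * (t⁻¹ * F (t * z))) (𝓝[>] 0) (𝓝 0) := by
    have h1 : Tendsto (fun t : ℝ => t ^ (1 - k)) (𝓝[>] 0) (𝓝 0) := by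
      have := (Real.continuousAt_rpow_const 0 (1 - k) (Or.inr (by linarith))).tendsto
      rw [Real.zero_rpow (by linarith)] at this
      exact this.mono_left nhdsWithin_le_nhds
    have h2 : Tendsto (fun t : ℝ => t⁻¹ * F (t * z)) (𝓝[>] 0) (𝓝 (fderiv ℝ F 0 z)) := by
      have := (hder 0 (by simp)).tendsto_slope_zero_right
      simpa [hF0] using this
    simpa using h1.mul h2
  refine hFz (tendsto_nhds_unique (hlim.congr' ?_) tendsto_const_nhds).symm
  filter_upwards [Ioc_mem_nhdsGT zero_lt_one] with t ht
  rw [hconst t ht, sub_eq_add_neg, Real.rpow_add ht.1, Real.rpow_one]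
  field_simp [ht.1.ne']

end Disc

/-! ### Conformal maps and the Laplacian in dimension two -/

section Conformal

variable {E : Type*} [NormedAddCommGroup E] [InnerProductSpace ℝ E]

theorem fderiv_fderiv_comp_apply {V W : Type*} [NormedAddCommGroup V] [NormedSpace ℝ V]
    [NormedAddCommGroup W] [NormedSpace ℝ W] {u : W → ℝ} {ψ : V → W} {z : V}
    (hu : ContDiffAt ℝ 2 u (ψ z)) (hψ : ContDiffAt ℝ 2 ψ z) (v w : V) :
    fderiv ℝ (fderiv ℝ (u ∘ ψ)) z v w =
      fderiv ℝ (fderiv ℝ u) (ψ z) (fderiv ℝ ψ z v) (fderiv ℝ ψ z w) +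
        fderiv ℝ u (ψ z) (fderiv ℝ (fderiv ℝ ψ) z v w) := by
  have h1 : fderiv ℝ (u ∘ ψ) =ᶠ[𝓝 z] fun y => (fderiv ℝ u (ψ y)).comp (fderiv ℝ ψ y) := by
    filter_upwards [hψ.eventually (by simp), hψ.continuousAt.eventually (hu.eventually (by simp))]
      with y h1 h2
    exact fderiv_comp y (h2.differentiableAt two_ne_zero) (h1.differentiableAt two_ne_zero)
  have h2 : DifferentiableAt ℝ (fderiv ℝ u) (ψ z) :=
    (hu.fderiv_right (m := 1) (by norm_num)).differentiableAt one_ne_zero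
  have h3 : DifferentiableAt ℝ (fderiv ℝ ψ) z :=
    (hψ.fderiv_right (m := 1) (by norm_num)).differentiableAt one_ne_zero
  have h4 : HasFDerivAt (fun y => fderiv ℝ u (ψ y))
      ((fderiv ℝ (fderiv ℝ u) (ψ z)).comp (fderiv ℝ ψ z)) z :=
    h2.hasFDerivAt.comp z (hψ.differentiableAt two_ne_zero).hasFDerivAt
  rw [h1.fderiv_eq, (h4.clm_comp h3.hasFDerivAt).fderiv]
  simp [add_comm]

theorem exists_orthonormalBasis_of_conformal (hE : Module.finrank ℝ E = 2) {A : ℂ →L[ℝ] E}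
    {m : ℝ} (hm : 0 < m) (hA : ∀ v w, inner ℝ (A v) (A w) = m * inner ℝ v w) :
    ∃ b : OrthonormalBasis (Fin 2) ℝ E, A 1 = √m • b 0 ∧ A Complex.I = √m • b 1 := by
  have := Module.finite_of_finrank_pos (R := ℝ) (M := E) (by omega)
  have h0 : √m ≠ 0 := (Real.sqrt_pos.2 hm).ne'
  have ho : Orthonormal ℝ fun i => (√m)⁻¹ • A (Complex.orthonormalBasisOneI i) := by
    rw [orthonormal_iff_ite]
    intro i j
    rw [inner_smul_left, inner_smul_right, hA, orthonormal_iff_ite.1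
      Complex.orthonormalBasisOneI.orthonormal]
    simp only [conj_trivial]
    rw [← mul_assoc, ← mul_assoc, ← mul_inv, Real.mul_self_sqrt hm.le, inv_mul_cancel₀ hm.ne',
      one_mul]
  obtain ⟨b, hb⟩ := (show Orthonormal ℝ ((univ : Set (Fin 2)).domRestrict fun i =>
    (√m)⁻¹ • A (Complex.orthonormalBasisOneI i)) from ho.comp _ Subtype.val_injective
    ).exists_orthonormalBasis_extension_of_card_eq (by simp [hE])
  refine ⟨b, ?_, ?_⟩
  · rw [hb 0 (mem_univ _), smul_inv_smul₀ h0]; simp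
  · rw [hb 1 (mem_univ _), smul_inv_smul₀ h0]; simp

/-- In dimension two a conformal map `ψ` is harmonic: differentiating `‖∂₁ψ‖² = ‖∂₂ψ‖²` and
`⟪∂₁ψ, ∂₂ψ⟫ = 0` shows that `∂₁∂₁ψ + ∂₂∂₂ψ` is orthogonal to `∂₁ψ` and `∂₂ψ`, which span. -/
theorem sum_fderiv_fderiv_eq_zero_of_conformal (hE : Module.finrank ℝ E = 2) {ψ : ℂ → E}
    {m : ℂ → ℝ} {z : ℂ} (hψ : ContDiffAt ℝ 2 ψ z) (hm : 0 < m z)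
    (hc : ∀ᶠ y in 𝓝 z, ∀ v w, inner ℝ (fderiv ℝ ψ y v) (fderiv ℝ ψ y w) = m y * inner ℝ v w) :
    fderiv ℝ (fderiv ℝ ψ) z 1 1 + fderiv ℝ (fderiv ℝ ψ) z Complex.I Complex.I = 0 := by
  set A := fderiv ℝ ψ z
  set B := fderiv ℝ (fderiv ℝ ψ) z
  have hB : HasFDerivAt (fderiv ℝ ψ) B z :=
    ((hψ.fderiv_right (m := 1) (by norm_num)).differentiableAt one_ne_zero).hasFDerivAt
  have hsymm : B Complex.I 1 = B 1 Complex.I := (hψ.isSymmSndFDerivAt (by simp)).eq _ _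
  have hq : ∀ v w u : ℂ, fderiv ℝ (fun y => inner ℝ (fderiv ℝ ψ y v) (fderiv ℝ ψ y w)) z u =
      inner ℝ (A v) (B u w) + inner ℝ (B u v) (A w) := by
    intro v w u
    have h := fun v : ℂ => hB.clm_apply (hasFDerivAt_const v z)
    rw [((h v).inner ℝ (h w)).fderiv]
    simp [A]
  have h1I : ∀ u, inner ℝ (A 1) (B u Complex.I) + inner ℝ (B u 1) (A Complex.I) = 0 := by
    intro u
    have : (fun y => inner ℝ (fderiv ℝ ψ y 1) (fderiv ℝ ψ y Complex.I)) =ᶠ[𝓝 z]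
        fun _ => (0 : ℝ) := by
      filter_upwards [hc] with y hy
      simp [hy]
    rw [← hq, this.fderiv_eq]
    simp
  have h11 : ∀ u, inner ℝ (A 1) (B u 1) + inner ℝ (B u 1) (A 1) =
      inner ℝ (A Complex.I) (B u Complex.I) + inner ℝ (B u Complex.I) (A Complex.I) := by
    intro u
    have : (fun y => inner ℝ (fderiv ℝ ψ y 1) (fderiv ℝ ψ y 1)) =ᶠ[𝓝 z]
        fun y => inner ℝ (fderiv ℝ ψ y Complex.I) (fderiv ℝ ψ y Complex.I) := by
      filter_upwards [hc] with y hy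
      rw [hy, hy]
      simp
    rw [← hq, ← hq, this.fderiv_eq]
  obtain ⟨b, hb0, hb1⟩ := exists_orthonormalBasis_of_conformal hE hm hc.self_of_nhds
  have hs : √(m z) ≠ 0 := (Real.sqrt_pos.2 hm).ne'
  have e1 : inner ℝ (A 1) (B 1 1 + B Complex.I Complex.I) = 0 := by
    have h1 := h11 1
    have h2 := h1I Complex.I
    rw [hsymm] at h2
    rw [inner_add_right]
    linarith [real_inner_comm (A 1) (B 1 1), real_inner_comm (A Complex.I) (B 1 Complex.I)]
  have e2 : inner ℝ (A Complex.I) (B 1 1 + B Complex.I Complex.I) = 0 := by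
    have h1 := h11 Complex.I
    have h2 := h1I 1
    rw [hsymm] at h1
    rw [inner_add_right]
    linarith [real_inner_comm (A Complex.I) (B 1 1), real_inner_comm (A 1) (B 1 Complex.I),
      real_inner_comm (A Complex.I) (B Complex.I Complex.I)]
  rw [show A 1 = _ from hb0, inner_smul_left] at e1
  rw [show A Complex.I = _ from hb1, inner_smul_left] at e2
  refine b.repr.injective (PiLp.ext fun i => ?_)
  rw [b.repr_apply_apply, map_zero]
  fin_cases i
  · simpa [hs] using e1
  · simpa [hs] using e2

/-- The Laplacian of a composition with a conformal map of planes. The trace of the second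
derivative is computed in the image of the standard basis of `ℂ`; the first derivative contributes
nothing because the map is harmonic. -/
theorem laplacian_comp_of_conformal [FiniteDimensional ℝ E] (hE : Module.finrank ℝ E = 2)
    {u : E → ℝ} {ψ : ℂ → E} {m : ℂ → ℝ} {z : ℂ} (hu : ContDiffAt ℝ 2 u (ψ z))
    (hψ : ContDiffAt ℝ 2 ψ z) (hm : 0 < m z)
    (hc : ∀ᶠ y in 𝓝 z, ∀ v w, inner ℝ (fderiv ℝ ψ y v) (fderiv ℝ ψ y w) = m y * inner ℝ v w) :
    Laplacian.laplacian (u ∘ ψ) z = m z * Laplacian.laplacian u (ψ z) := by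
  obtain ⟨b, h0, h1⟩ := exists_orthonormalBasis_of_conformal hE hm hc.self_of_nhds
  rw [laplacian_eq_iteratedFDeriv_complexPlane, laplacian_eq_iteratedFDeriv_orthonormalBasis u b]
  have hs := sum_fderiv_fderiv_eq_zero_of_conformal hE hψ hm hc
  have hs' := congrArg (fderiv ℝ u (ψ z)) hs
  rw [map_add, map_zero] at hs'
  simp only [iteratedFDeriv_two_apply, Matrix.cons_val_zero, Matrix.cons_val_one,
    Fin.sum_univ_two, fderiv_fderiv_comp_apply hu hψ, h0, h1, map_smul,
    smul_apply, smul_eq_mul]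
  have : √(m z) * √(m z) = m z := Real.mul_self_sqrt hm.le
  linear_combination hs' + (fderiv ℝ (fderiv ℝ u) (ψ z) (b 0) (b 0) +
    fderiv ℝ (fderiv ℝ u) (ψ z) (b 1) (b 1)) * this

/-- For a metric that is conformal to the scalar product of the coordinates, the
Laplace–Beltrami operator is the Laplacian of the coordinates up to a factor. -/
theorem laplaceBeltrami_eq_of_conformal [FiniteDimensional ℝ E] {M : Type*} [TopologicalSpace M]
    [ChartedSpace E M] (g : RMetric E M) (b : OrthonormalBasis (Fin 2) ℝ E) {f : M → ℝ} {x : M}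
    {m : E → ℝ} (hm : ∀ᶠ y in 𝓝 (chartAt E x x), 0 < m y ∧ gramMatrix g b.toBasis x y = m y • 1)
    (hf : ContDiffAt ℝ 2 (f ∘ (chartAt E x).symm) (chartAt E x x)) :
    laplaceBeltrami g b.toBasis f x =
      (m (chartAt E x x))⁻¹ *
        Laplacian.laplacian (f ∘ (chartAt E x).symm) (chartAt E x x) := by
  have key : ∀ i, (fun y : E => ∑ j, √(gramMatrix g b.toBasis x y).det *
      (gramMatrix g b.toBasis x y)⁻¹ i j * fderiv ℝ (f ∘ (chartAt E x).symm) y (b.toBasis j))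
      =ᶠ[𝓝 (chartAt E x x)] fun y => fderiv ℝ (f ∘ (chartAt E x).symm) y (b i) := by
    intro i
    filter_upwards [hm] with y ⟨h0, h1⟩
    have hd : √(m y • (1 : Matrix (Fin 2) (Fin 2) ℝ)).det = m y := by
      rw [Matrix.det_smul]; simp [Real.sqrt_sq h0.le]
    have hi : (m y • (1 : Matrix (Fin 2) (Fin 2) ℝ))⁻¹ = (m y)⁻¹ • 1 := by
      apply Matrix.inv_eq_right_inv
      rw [smul_mul_smul_comm, mul_inv_cancel₀ h0.ne', one_smul, one_mul]
    rw [h1, hd, hi, Finset.sum_eq_single i]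
    · simp [h0.ne']
    · intro j _ hj
      simp [Matrix.one_apply_ne' hj]
    · simp
  have hD : DifferentiableAt ℝ (fderiv ℝ (f ∘ (chartAt E x).symm)) (chartAt E x x) :=
    (hf.fderiv_right (m := 1) (by norm_num)).differentiableAt one_ne_zero
  obtain ⟨h0, h1⟩ := hm.self_of_nhds
  rw [laplaceBeltrami, laplacian_eq_iteratedFDeriv_orthonormalBasis _ b]
  congr 1
  · rw [h1, Matrix.det_smul]; simp [Real.sqrt_sq h0.le]
  · refine Finset.sum_congr rfl fun i _ => ?_
    rw [(key i).fderiv_eq, fderiv_clm_apply hD (by fun_prop)]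
    simp [iteratedFDeriv_two_apply]

end Conformal

/-! ### Conformal coordinates -/

section ConformalCoordinate

variable {E : Type*} [NormedAddCommGroup E] [InnerProductSpace ℝ E]
  {M : Type*} [TopologicalSpace M] [ChartedSpace E M]

/-- The scalar product of `g` at `x`, as a bilinear form on the model space `E`, of which every
tangent space of `M` is a copy. -/
def RMetric.form (g : RMetric E M) (x : M) : E →L[ℝ] E →L[ℝ] ℝ :=
  g.inner x

/-- The differential at `z` of a parametrization `φ` of `M` by a normed space, as a map into the
model space of `M`. -/
noncomputable def paramDeriv {V : Type*} [NormedAddCommGroup V] [NormedSpace ℝ V] (φ : V → M)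
    (z : V) : V →L[ℝ] E :=
  mfderiv 𝓘(ℝ, V) 𝓘(ℝ, E) φ z

/-- The parametrization `φ` of `M` pulls the metric `g` back, at `z`, to `m` times the scalar
product. -/
def IsConformalAt {V : Type*} [NormedAddCommGroup V] [InnerProductSpace ℝ V] (g : RMetric E M)
    (φ : V → M) (m : ℝ) (z : V) : Prop :=
  ∀ v w : V, g.form (φ z) (paramDeriv φ z v) (paramDeriv φ z w) = m * inner ℝ v w

/-- `e` is a conformal coordinate with values in `ℂ` that maps `Ω` onto the disc of radius `ρ`
around `0`. On the bounding circle it pulls `g` back to `s ^ 2` times the scalar product, so that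
`s` scales lengths. -/
structure IsConformalDisc (g : RMetric E M) (e : OpenPartialHomeomorph M ℂ) (ρ s : ℝ) (Ω : Set M) :
    Prop where
  radius_pos : 0 < ρ
  factor_pos : 0 < s
  contMDiffOn : ContMDiffOn 𝓘(ℝ, E) 𝓘(ℝ, ℂ) 2 e e.source
  contMDiffOn_symm : ContMDiffOn 𝓘(ℝ, ℂ) 𝓘(ℝ, E) 2 e.symm e.target
  conformal : ∀ z ∈ e.target, ∃ m > 0, IsConformalAt g e.symm m z
  conformal_boundary : ∀ z, ‖z‖ = ρ → IsConformalAt g e.symm (s ^ 2) z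
  closedBall_subset : closedBall 0 ρ ⊆ e.target
  mem_iff : ∀ x, x ∈ Ω ↔ x ∈ e.source ∧ ‖e x‖ < ρ

namespace IsConformalDisc

variable {g : RMetric E M} {e : OpenPartialHomeomorph M ℂ} {ρ s : ℝ} {Ω : Set M}

theorem eq_image_ball (h : IsConformalDisc g e ρ s Ω) : Ω = e.symm '' ball 0 ρ := by
  ext x
  rw [h.mem_iff]
  constructor
  · rintro ⟨h1, h2⟩
    exact ⟨e x, by simpa using h2, e.left_inv h1⟩
  · rintro ⟨z, hz, rfl⟩
    have hz' := h.closedBall_subset (ball_subset_closedBall hz)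
    refine ⟨e.map_target hz', ?_⟩
    rw [e.right_inv hz']
    simpa using hz

theorem isOpen (h : IsConformalDisc g e ρ s Ω) : IsOpen Ω := by
  rw [h.eq_image_ball]
  exact e.symm.isOpen_image_of_subset_source isOpen_ball
    (ball_subset_closedBall.trans h.closedBall_subset)

theorem closure_eq [T2Space M] (h : IsConformalDisc g e ρ s Ω) :
    closure Ω = e.symm '' closedBall 0 ρ := by
  have hc : ContinuousOn e.symm (closedBall 0 ρ) := e.continuousOn_symm.mono h.closedBall_subset
  apply Subset.antisymm
  · refine closure_minimal ?_ ((isCompact_closedBall 0 ρ).image_of_continuousOn hc).isClosed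
    rw [h.eq_image_ball]
    exact image_mono ball_subset_closedBall
  · rw [h.eq_image_ball, ← closure_ball (0 : ℂ) h.radius_pos.ne']
    rw [← closure_ball (0 : ℂ) h.radius_pos.ne'] at hc
    exact hc.image_closure

theorem closure_subset [T2Space M] (h : IsConformalDisc g e ρ s Ω) : closure Ω ⊆ e.source := by
  rw [h.closure_eq]
  rintro _ ⟨z, hz, rfl⟩
  exact e.map_target (h.closedBall_subset hz)

theorem frontier_eq [T2Space M] (h : IsConformalDisc g e ρ s Ω) :
    frontier Ω = e.symm '' sphere 0 ρ := by
  rw [h.isOpen.frontier_eq, h.closure_eq, h.eq_image_ball,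
    ← closedBall_sdiff_ball, InjOn.image_sdiff_subset]
  · exact e.symm.injOn.mono h.closedBall_subset
  · exact ball_subset_closedBall

theorem contMDiffAt_symm (h : IsConformalDisc g e ρ s Ω) {z : ℂ} (hz : z ∈ e.target) :
    ContMDiffAt 𝓘(ℝ, ℂ) 𝓘(ℝ, E) 2 e.symm z :=
  (h.contMDiffOn_symm z hz).contMDiffAt (e.open_target.mem_nhds hz)

theorem contMDiffAt (h : IsConformalDisc g e ρ s Ω) {x : M} (hx : x ∈ e.source) :
    ContMDiffAt 𝓘(ℝ, E) 𝓘(ℝ, ℂ) 2 e x :=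
  (h.contMDiffOn x hx).contMDiffAt (e.open_source.mem_nhds hx)

theorem mdifferentiableAt_symm (h : IsConformalDisc g e ρ s Ω) {z : ℂ} (hz : z ∈ e.target) :
    MDifferentiableAt 𝓘(ℝ, ℂ) 𝓘(ℝ, E) e.symm z :=
  (h.contMDiffAt_symm hz).mdifferentiableAt two_ne_zero

theorem mdifferentiableAt (h : IsConformalDisc g e ρ s Ω) {x : M} (hx : x ∈ e.source) :
    MDifferentiableAt 𝓘(ℝ, E) 𝓘(ℝ, ℂ) e x :=
  (h.contMDiffAt hx).mdifferentiableAt two_ne_zero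

theorem fderivWithin_comp_symm [T2Space M] (h : IsConformalDisc g e ρ s Ω) {f : M → ℝ} {z : ℂ}
    (hz : z ∈ closedBall (0 : ℂ) ρ)
    (hf : MDifferentiableWithinAt 𝓘(ℝ, E) 𝓘(ℝ, ℝ) f (closure Ω) (e.symm z)) (v : ℂ) :
    fderivWithin ℝ (f ∘ e.symm) (closedBall 0 ρ) z v =
      mvfderivWithin 𝓘(ℝ, E) f (closure Ω) (e.symm z) (paramDeriv (E := E) e.symm z v) := by
  have h1 : HasMFDerivWithinAt 𝓘(ℝ, ℂ) 𝓘(ℝ, E) e.symm (closedBall 0 ρ) z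
      (mfderiv 𝓘(ℝ, ℂ) 𝓘(ℝ, E) e.symm z) :=
    (h.mdifferentiableAt_symm (h.closedBall_subset hz)).hasMFDerivAt.hasMFDerivWithinAt
  have h2 := HasMFDerivWithinAt.comp z hf.hasMFDerivWithinAt h1 (by
    rw [← image_subset_iff, h.closure_eq])
  let A : E →L[ℝ] ℝ := mfderivWithin 𝓘(ℝ, E) 𝓘(ℝ, ℝ) f (closure Ω) (e.symm z)
  have h3 : HasFDerivWithinAt (f ∘ e.symm) (A.comp (paramDeriv (E := E) e.symm z))
      (closedBall 0 ρ) z :=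
    hasMFDerivWithinAt_iff_hasFDerivWithinAt.1 h2
  exact DFunLike.congr_fun
    (h3.fderivWithin (uniqueDiffOn_closedBall_complex h.radius_pos z hz)) v

/-- In a conformal coordinate the Laplacian and the Laplace–Beltrami operator differ by a positive
factor. The latter is computed at `x` in the preferred chart of `M` there; the transition map from
the coordinate `e` to this chart is conformal, since both are. -/
theorem exists_laplacian_comp_symm_eq [FiniteDimensional ℝ E] [IsManifold 𝓘(ℝ, E) 2 M]
    (hE : Module.finrank ℝ E = 2) (b : OrthonormalBasis (Fin 2) ℝ E)
    (hchart : ∀ (x : M), ∀ y ∈ (chartAt E x).target, ∃ m > 0,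
      IsConformalAt g (chartAt E x).symm m y)
    (h : IsConformalDisc g e ρ s Ω) {x : M} (hx : x ∈ e.source) {f : M → ℝ}
    (hf : ContMDiffAt 𝓘(ℝ, E) 𝓘(ℝ, ℝ) 2 f x) :
    ∃ μ > 0, Laplacian.laplacian (f ∘ e.symm) (e x) = μ * laplaceBeltrami g b.toBasis f x := by
  set c := chartAt E x with hc
  have hcx : x ∈ c.source := mem_chart_source E x
  choose! m₁ hm₁ hg₁ using hchart x
  choose! m₂ hm₂ hg₂ using h.conformal
  set ψ : ℂ → E := c ∘ e.symm with hψ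
  set u : E → ℝ := f ∘ c.symm with hu
  have hψz : ψ (e x) = c x := by simp [hψ, e.left_inv hx]
  have hchartsymm : ∀ y ∈ c.target, ContMDiffAt 𝓘(ℝ, E) 𝓘(ℝ, E) 2 c.symm y := fun y hy =>
    (contMDiffOn_chart_symm (I := 𝓘(ℝ, E)) (n := 2) (x := x) y hy).contMDiffAt
      (c.open_target.mem_nhds hy)
  have hev : ∀ᶠ y in 𝓝 (e x), y ∈ e.target ∧ e.symm y ∈ c.source := by
    have h1 : e.target ∈ 𝓝 (e x) := e.open_target.mem_nhds (e.map_source hx)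
    refine Filter.Eventually.and h1 ?_
    have h2 : ContinuousAt e.symm (e x) := e.continuousAt_symm (e.map_source hx)
    apply h2.eventually_mem
    rw [e.left_inv hx]
    exact c.open_source.mem_nhds hcx
  have hψC : ∀ y, y ∈ e.target ∧ e.symm y ∈ c.source → ContDiffAt ℝ 2 ψ y := by
    rintro y ⟨h1, h2⟩
    rw [← contMDiffAt_iff_contDiffAt]
    refine ContMDiffAt.comp y ?_ (h.contMDiffAt_symm h1)
    exact (contMDiffOn_chart (I := 𝓘(ℝ, E)) (n := 2) (x := x) _ h2).contMDiffAt
      (c.open_source.mem_nhds h2)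
  have huC : ContDiffAt ℝ 2 u (c x) := by
    rw [← contMDiffAt_iff_contDiffAt]
    refine ContMDiffAt.comp (c x) ?_ (hchartsymm _ (c.map_source hcx))
    rwa [c.left_inv hcx]
  have hcomp : u ∘ ψ =ᶠ[𝓝 (e x)] f ∘ e.symm := by
    filter_upwards [hev] with y hy
    simp [hu, hψ, c.left_inv hy.2]
  have hconf : ∀ᶠ y in 𝓝 (e x), ∀ v w,
      inner ℝ (fderiv ℝ ψ y v) (fderiv ℝ ψ y w) = ((m₁ (ψ y))⁻¹ * m₂ y) * inner ℝ v w := by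
    filter_upwards [hev.eventually_nhds] with y hy v w
    have hy0 := hy.self_of_nhds
    have hψy : ψ y ∈ c.target := c.map_source hy0.2
    have h1 : c.symm ∘ ψ =ᶠ[𝓝 y] e.symm := by
      filter_upwards [hy] with y' hy'
      simp [hψ, c.left_inv hy'.2]
    have h2 : paramDeriv (c.symm ∘ ψ) y = (paramDeriv c.symm (ψ y)).comp (fderiv ℝ ψ y) :=
      (HasMFDerivAt.comp y ((hchartsymm _ hψy).mdifferentiableAt two_ne_zero).hasMFDerivAt
        ((hψC y hy0).differentiableAt two_ne_zero).hasFDerivAt.hasMFDerivAt).mfderiv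
    have h3 : paramDeriv (c.symm ∘ ψ) y = paramDeriv (E := E) e.symm y := h1.mfderiv_eq
    have h4 := hg₂ y hy0.1 v w
    have h5 := hg₁ (ψ y) hψy (fderiv ℝ ψ y v) (fderiv ℝ ψ y w)
    have h6 : c.symm (ψ y) = e.symm y := h1.self_of_nhds
    rw [← h3, h2, ← h6] at h4
    have h7 := hm₁ _ hψy
    have h8 := h5.symm.trans h4
    field_simp
    linarith
  have hm₁x := hm₁ _ (c.map_source hcx)
  have hm₂x := hm₂ _ (e.map_source hx)
  have hlb : laplaceBeltrami g b.toBasis f x = (m₁ (c x))⁻¹ * Laplacian.laplacian u (c x) := by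
    refine laplaceBeltrami_eq_of_conformal g b ?_ huC
    filter_upwards [c.open_target.mem_nhds (c.map_source hcx)] with y hy
    refine ⟨hm₁ y hy, ?_⟩
    ext i j
    have h1 : gramMatrix g b.toBasis x y i j = m₁ y * inner ℝ (b i) (b j) := by
      have := hg₁ y hy (b i) (b j)
      rw [← this, gramMatrix, Matrix.of_apply, b.coe_toBasis]
      rfl
    rw [h1, orthonormal_iff_ite.1 b.orthonormal]
    simp [Matrix.one_apply]
  have hlap := laplacian_comp_of_conformal hE (z := e x) (u := u) (by rwa [hψz])
    (hψC _ hev.self_of_nhds) (by rw [hψz]; positivity) hconf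
  rw [laplacian_congr_nhds hcomp |>.self_of_nhds, hψz] at hlap
  exact ⟨m₂ (e x), hm₂x, by rw [hlap, hlb]; ring⟩

end IsConformalDisc

end ConformalCoordinate

/-! ### The Steklov problem in a conformal disc -/

section Eigenvalue

theorem norm_exp_mul_I_mul (t : ℝ) (z : ℂ) : ‖Complex.exp (t * Complex.I) * z‖ = ‖z‖ := by
  rw [norm_mul, Complex.norm_exp_ofReal_mul_I, one_mul]

theorem hasDerivAt_exp_mul_I_mul (a : ℝ) (z : ℂ) :
    HasDerivAt (fun t : ℝ => Complex.exp ((a * t : ℝ) * Complex.I) * z) (a * Complex.I * z) 0 := by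
  have h1 : HasDerivAt (fun t : ℝ => ((a * t : ℝ) : ℂ) * Complex.I) (a * Complex.I) 0 := by
    simpa using (((hasDerivAt_id (0 : ℝ)).const_mul a).ofReal_comp).mul_const Complex.I
  simpa using (h1.cexp).mul_const z

theorem inner_deriv_nonpos {γ : ℝ → ℂ} {γ' : ℂ} (hγ : HasDerivAt γ γ' 0)
    (hle : ∀ᶠ t in 𝓝[≥] (0 : ℝ), ‖γ t‖ ≤ ‖γ 0‖) : inner ℝ (γ 0) γ' ≤ 0 := by
  have h1 : HasDerivAt (fun t => ‖γ t‖ ^ 2) (2 * inner ℝ (γ 0) γ') 0 := hγ.norm_sq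
  have := le_of_tendsto h1.tendsto_slope_zero_right (b := 0) (by
    filter_upwards [self_mem_nhdsWithin, nhdsWithin_mono _ Ioi_subset_Ici_self hle] with t ht h4
    rw [zero_add]
    refine mul_nonpos_of_nonneg_of_nonpos (inv_nonneg.2 (mem_Ioi.1 ht).le) (sub_nonpos.2 ?_)
    gcongr)
  linarith

/-- A vector of length `s⁻¹` orthogonal to `i z`, with nonnegative scalar product with `z`, is the
positive multiple of `z` of that length. -/
theorem eq_smul_of_inner_I_mul_eq_zero {ρ s : ℝ} (hρ : 0 < ρ) (hs : 0 < s) {z w : ℂ} (hz : ‖z‖ = ρ)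
    (hw : s ^ 2 * inner ℝ w w = 1) (h1 : 0 ≤ inner ℝ w z) (h2 : inner ℝ w (Complex.I * z) = 0) :
    w = (ρ * s)⁻¹ • z := by
  have hz2 : z.re * z.re + z.im * z.im = ρ ^ 2 := by
    rw [← hz, Complex.sq_norm, Complex.normSq_apply]
  obtain ⟨c, hc⟩ : ∃ c, c = inner ℝ w z := ⟨_, rfl⟩
  rw [← hc] at h1
  simp only [Complex.inner, Complex.mul_re, Complex.mul_im, Complex.conj_re, Complex.conj_im,
    Complex.I_re, Complex.I_im] at hc h2 hw
  have hre : ρ ^ 2 * w.re = c * z.re := by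
    rw [hc, ← hz2]; linear_combination -z.im * h2
  have him : ρ ^ 2 * w.im = c * z.im := by
    rw [hc, ← hz2]; linear_combination z.re * h2
  have hcs : s * c = ρ := by
    have h3 : (s * c) ^ 2 = ρ ^ 2 := by
      have h4 : ρ ^ 2 * (s * c) ^ 2 = ρ ^ 2 * ρ ^ 2 := by
        linear_combination (ρ ^ 4) * hw - s ^ 2 * c ^ 2 * hz2 -
          s ^ 2 * (ρ ^ 2 * w.re + c * z.re) * hre - s ^ 2 * (ρ ^ 2 * w.im + c * z.im) * him
      exact mul_left_cancel₀ (by positivity) h4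
    nlinarith [mul_nonneg hs.le h1]
  have hρ2 : ρ ^ 2 ≠ 0 := by positivity
  apply Complex.ext
  · rw [Complex.smul_re, smul_eq_mul]
    apply mul_left_cancel₀ hρ2
    rw [hre]
    field_simp
    linear_combination z.re * hcs
  · rw [Complex.smul_im, smul_eq_mul]
    apply mul_left_cancel₀ hρ2
    rw [him]
    field_simp
    linear_combination z.im * hcs

variable {E : Type*} [NormedAddCommGroup E] [InnerProductSpace ℝ E]
  {M : Type*} [TopologicalSpace M] [ChartedSpace E M]

/-- The definition of the outward unit normal, without transport between tangent spaces. -/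
theorem isOutwardUnitNormal_iff {g : RMetric E M} {Ω : Set M} {x : M} {η : E} :
    IsOutwardUnitNormal g Ω x η ↔ g.form x η η = 1 ∧
      ∀ c : ℝ → M, c 0 = x → MDifferentiableAt 𝓘(ℝ, ℝ) 𝓘(ℝ, E) c 0 →
        (∀ᶠ t in 𝓝[≥] (0 : ℝ), c t ∈ closure Ω) → g.form x η (paramDeriv c 0 1) ≤ 0 := by
  refine and_congr Iff.rfl (forall_congr' fun c => forall_congr' fun hc => ?_)
  subst hc
  exact Iff.rfl

namespace IsConformalDisc

variable {g : RMetric E M} {e : OpenPartialHomeomorph M ℂ} {ρ s : ℝ} {Ω : Set M}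

theorem paramDeriv_comp (h : IsConformalDisc g e ρ s Ω) {γ : ℝ → ℂ} {γ' : ℂ}
    (hγ : HasDerivAt γ γ' 0) (h0 : γ 0 ∈ e.target) :
    MDifferentiableAt 𝓘(ℝ, ℝ) 𝓘(ℝ, E) (e.symm ∘ γ) 0 ∧
      paramDeriv (E := E) (e.symm ∘ γ) 0 1 = paramDeriv (E := E) e.symm (γ 0) γ' := by
  have h1 := HasMFDerivAt.comp (0 : ℝ) (h.mdifferentiableAt_symm h0).hasMFDerivAt
    hγ.hasFDerivAt.hasMFDerivAt
  refine ⟨h1.mdifferentiableAt, ?_⟩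
  have h2 : paramDeriv (e.symm ∘ γ) 0 = (paramDeriv (E := E) e.symm (γ 0)).comp
      (ContinuousLinearMap.toSpanSingleton ℝ γ') := h1.mfderiv
  rw [h2]
  simp

/-- The outward unit normal is the radial direction of the disc, normalized. -/
theorem isOutwardUnitNormal_iff [T2Space M] (hE : Module.finrank ℝ E = 2)
    (h : IsConformalDisc g e ρ s Ω) {z : ℂ} (hz : ‖z‖ = ρ) {η : E} :
    IsOutwardUnitNormal g Ω (e.symm z) η ↔
      η = (ρ * s)⁻¹ • paramDeriv (E := E) e.symm z z := by
  have hρ := h.radius_pos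
  have hs := h.factor_pos
  have hzb : z ∈ closedBall (0 : ℂ) ρ := by simp [hz]
  have hzt : z ∈ e.target := h.closedBall_subset hzb
  have hconf := h.conformal_boundary z hz
  have hz2 : inner ℝ z z = ρ ^ 2 := by rw [real_inner_self_eq_norm_sq, hz]
  rw [Steklov.isOutwardUnitNormal_iff]
  constructor
  · rintro ⟨h1, h2⟩
    have hcurve : ∀ (γ : ℝ → ℂ) (γ' : ℂ), HasDerivAt γ γ' 0 → γ 0 = z →
        (∀ᶠ t in 𝓝[≥] (0 : ℝ), ‖γ t‖ ≤ ρ) →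
        g.form (e.symm z) η (paramDeriv (E := E) e.symm z γ') ≤ 0 := by
      intro γ γ' hγ h0 hle
      obtain ⟨h3, h4⟩ := h.paramDeriv_comp hγ (h0 ▸ hzt)
      rw [h0] at h4
      rw [← h4]
      refine h2 _ (by simp [h0]) h3 ?_
      filter_upwards [hle] with t ht
      rw [h.closure_eq]
      exact ⟨γ t, by simpa using ht, rfl⟩
    have hsurj : Function.Surjective (paramDeriv (E := E) e.symm z) := by
      have := Module.finite_of_finrank_pos (R := ℝ) (M := E) (by omega)
      refine (LinearMap.injective_iff_surjective_of_finrank_eq_finrank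
        (f := (paramDeriv (E := E) e.symm z).toLinearMap) (by simp [hE])).1 ?_
      rw [injective_iff_map_eq_zero]
      intro v hv
      have h3 := hconf v v
      rw [show paramDeriv (E := E) e.symm z v = 0 from hv, map_zero] at h3
      have h4 : s ^ 2 * inner ℝ v v = 0 := by simpa using h3.symm
      simpa [hs.ne'] using h4
    obtain ⟨w, rfl⟩ := hsurj η
    rw [hconf] at h1
    simp only [show ∀ v, g.form (e.symm z) (paramDeriv (E := E) e.symm z w)
      (paramDeriv (E := E) e.symm z v) = s ^ 2 * inner ℝ w v from hconf w] at hcurve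
    -- The radius towards the centre and both directions of the circle stay in the closure.
    have hrad := hcurve (fun t => ((1 - t : ℝ) : ℂ) * z) (-z) (by
        simpa using (((hasDerivAt_id (0 : ℝ)).const_sub 1).ofReal_comp).mul_const z) (by simp) (by
      filter_upwards [Icc_mem_nhdsGE (zero_lt_one (α := ℝ))] with t ht
      rw [norm_mul, Complex.norm_real, hz, Real.norm_of_nonneg (by linarith [ht.2])]
      nlinarith [ht.1])
    have hrot : ∀ a : ℝ, s ^ 2 * inner ℝ w (a * Complex.I * z) ≤ 0 := fun a =>
      hcurve _ _ (hasDerivAt_exp_mul_I_mul a z) (by simp) (Eventually.of_forall fun t => by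
        rw [norm_exp_mul_I_mul, hz])
    have hr1 := hrot 1
    have hr2 := hrot (-1)
    have hs2 : 0 < s ^ 2 := by positivity
    have e1 : 0 ≤ inner ℝ w z := by
      rw [inner_neg_right] at hrad
      nlinarith
    have e2 : inner ℝ w (Complex.I * z) = 0 := by
      simp only [Complex.ofReal_one, one_mul, Complex.ofReal_neg, neg_mul,
        inner_neg_right] at hr1 hr2
      nlinarith
    rw [← map_smul]
    congr 1
    exact eq_smul_of_inner_I_mul_eq_zero hρ hs hz h1 e1 e2
  · rintro rfl
    constructor
    · rw [← map_smul, hconf]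
      rw [inner_smul_left, inner_smul_right, hz2]
      simp
      field_simp
    · intro c hc hcd hcl
      -- In the coordinate, a curve in the closure starts at maximal distance from the centre.
      have hce : ContinuousAt c 0 := hcd.continuousAt
      have hsrc : c 0 ∈ e.source := by rw [hc]; exact e.map_target hzt
      have hγ : HasDerivAt (e ∘ c) (fderiv ℝ (e ∘ c) 0 1) 0 := by
        have := (h.mdifferentiableAt hsrc).comp (0 : ℝ) hcd
        exact this.differentiableAt.hasDerivAt
      have h0 : (e ∘ c) 0 = z := by simp [hc, e.right_inv hzt]
      have h1 : e.symm ∘ (e ∘ c) =ᶠ[𝓝 0] c := by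
        filter_upwards [hce.eventually_mem (e.open_source.mem_nhds hsrc)] with t ht
        simp [e.left_inv ht]
      have h2 : paramDeriv (E := E) (e.symm ∘ (e ∘ c)) 0 = paramDeriv (E := E) c 0 :=
        h1.mfderiv_eq
      have h3 := (h.paramDeriv_comp hγ (h0 ▸ hzt)).2
      rw [h2, h0] at h3
      have h4 := inner_deriv_nonpos hγ (by
        filter_upwards [hcl] with t ht
        rw [h.closure_eq] at ht
        obtain ⟨y, hy, hyt⟩ := ht
        rw [h0, hz, Function.comp_apply, ← hyt, e.right_inv (h.closedBall_subset hy)]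
        simpa using hy)
      rw [h3, ← map_smul, hconf, inner_smul_left, ← h0]
      have : 0 ≤ s ^ 2 * (ρ * s)⁻¹ := by positivity
      simp only [conj_trivial]
      rw [← mul_assoc]
      exact mul_nonpos_of_nonneg_of_nonpos this h4

theorem mvfderivWithin_smul_paramDeriv [T2Space M] (h : IsConformalDisc g e ρ s Ω) {f : M → ℝ}
    {z : ℂ} (hz : z ∈ closedBall (0 : ℂ) ρ)
    (hf : MDifferentiableWithinAt 𝓘(ℝ, E) 𝓘(ℝ, ℝ) f (closure Ω) (e.symm z)) (a : ℝ) (v : ℂ) :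
    mvfderivWithin 𝓘(ℝ, E) f (closure Ω) (e.symm z) (a • paramDeriv (E := E) e.symm z v) =
      a * fderivWithin ℝ (f ∘ e.symm) (closedBall 0 ρ) z v := by
  rw [h.fderivWithin_comp_symm hz hf v]
  exact ContinuousLinearMap.map_smul
    (mvfderivWithin 𝓘(ℝ, E) f (closure Ω) (e.symm z) : E →L[ℝ] ℝ) a _

/-- In a conformal coordinate with constant factor on the boundary the Steklov problem becomes the
Steklov problem of a flat disc, up to the factor `s`. The real part of the coordinate is an
eigenfunction for the first nonzero eigenvalue. -/
theorem isFirstNonzeroSteklovEigenvalue [FiniteDimensional ℝ E] [IsManifold 𝓘(ℝ, E) 2 M]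
    [T2Space M] (hE : Module.finrank ℝ E = 2) (b : OrthonormalBasis (Fin 2) ℝ E)
    (hchart : ∀ (x : M), ∀ y ∈ (chartAt E x).target, ∃ m > 0,
      IsConformalAt g (chartAt E x).symm m y)
    (h : IsConformalDisc g e ρ s Ω) :
    IsFirstNonzeroSteklovEigenvalue g b.toBasis Ω (1 / (ρ * s)) := by
  have hρ := h.radius_pos
  have hs := h.factor_pos
  have hΩ : Ω ⊆ e.source := fun x hx => ((h.mem_iff x).1 hx).1
  have hbd : ∀ z : ℂ, ‖z‖ = ρ → z ∈ closedBall (0 : ℂ) ρ := fun z hz => by simp [hz]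
  have hfr : ∀ z : ℂ, ‖z‖ = ρ → e.symm z ∈ frontier Ω := fun z hz => by
    rw [h.frontier_eq]
    exact ⟨z, by simpa using hz, rfl⟩
  refine ⟨⟨by positivity, fun x => (e x).re, ?_, ?_, ?_, ?_, ?_⟩, ?_⟩
  · exact Complex.reCLM.contDiff.contMDiff.comp_contMDiffOn (h.contMDiffOn.mono hΩ)
  · exact Complex.reCLM.contDiff.contMDiff.comp_contMDiffOn
      ((h.contMDiffOn.mono h.closure_subset).of_le one_le_two)
  · have hmem : ((ρ / 2 : ℝ) : ℂ) ∈ ball (0 : ℂ) ρ := by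
      rw [mem_ball_zero_iff, Complex.norm_real, Real.norm_of_nonneg (by positivity)]
      linarith
    refine ⟨e.symm ((ρ / 2 : ℝ) : ℂ), h.eq_image_ball ▸ ⟨_, hmem, rfl⟩, ?_⟩
    rw [e.right_inv (h.closedBall_subset (ball_subset_closedBall hmem)), Complex.ofReal_re]
    positivity
  · intro x hx
    have hC : ContMDiffAt 𝓘(ℝ, E) 𝓘(ℝ, ℝ) 2 (fun x => (e x).re) x :=
      Complex.reCLM.contDiff.contMDiff.contMDiffAt.comp x (h.contMDiffAt (hΩ hx))
    obtain ⟨μ, hμ, hlap⟩ := h.exists_laplacian_comp_symm_eq hE b hchart (hΩ hx) hC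
    have h1 : (fun x => (e x).re) ∘ e.symm =ᶠ[𝓝 (e x)] fun z => (id z : ℂ).re := by
      filter_upwards [e.open_target.mem_nhds (e.map_source (hΩ hx))] with z hz
      simp [e.right_inv hz]
    have h2 : HarmonicAt (fun z => (id z : ℂ).re) (e x) := analyticAt_id.harmonicAt_re
    rw [(laplacian_congr_nhds h1).self_of_nhds, h2.2.self_of_nhds] at hlap
    simpa [hμ.ne'] using hlap.symm
  · intro x hx η hη
    rw [h.frontier_eq] at hx
    obtain ⟨z, hz, rfl⟩ := hx
    rw [mem_sphere_zero_iff_norm] at hz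
    have hzt := h.closedBall_subset (hbd z hz)
    have hC : MDifferentiableAt 𝓘(ℝ, E) 𝓘(ℝ, ℝ) (fun x => (e x).re) (e.symm z) :=
      (Complex.reCLM.contDiff.contMDiff (n := 1)).mdifferentiable one_ne_zero _ |>.comp _
        (h.mdifferentiableAt (e.map_target hzt))
    have h2 : fderivWithin ℝ ((fun x => (e x).re) ∘ e.symm) (closedBall 0 ρ) z = Complex.reCLM := by
      rw [fderivWithin_congr (f := Complex.reCLM) _ (by simp [e.right_inv hzt])]
      · exact Complex.reCLM.fderivWithin (uniqueDiffOn_closedBall_complex hρ z (hbd z hz))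
      · intro y hy
        simp [e.right_inv (h.closedBall_subset hy)]
    rw [show η = _ from (h.isOutwardUnitNormal_iff hE hz).1 hη]
    refine (h.mvfderivWithin_smul_paramDeriv (hbd z hz) hC.mdifferentiableWithinAt _ z).trans ?_
    rw [h2, e.right_inv hzt, one_div]
    rfl
  · rintro ν ⟨hν, f, hf⟩
    set F : ℂ → ℝ := f ∘ e.symm with hF
    have hf2 : ∀ z ∈ ball (0 : ℂ) ρ, ContMDiffAt 𝓘(ℝ, E) 𝓘(ℝ, ℝ) 2 f (e.symm z) := fun z hz => by
      have hzΩ : e.symm z ∈ Ω := h.eq_image_ball ▸ ⟨z, hz, rfl⟩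
      exact (hf.contMDiffOn _ hzΩ).contMDiffAt (h.isOpen.mem_nhds hzΩ)
    have hharm : HarmonicOnNhd F (ball 0 ρ) := by
      intro z hz
      constructor
      · rw [← contMDiffAt_iff_contDiffAt]
        exact (hf2 z hz).comp z
          (h.contMDiffAt_symm (h.closedBall_subset (ball_subset_closedBall hz)))
      · filter_upwards [isOpen_ball.mem_nhds hz] with y hy
        have hyt := h.closedBall_subset (ball_subset_closedBall hy)
        have hyΩ : e.symm y ∈ Ω := h.eq_image_ball ▸ ⟨y, hy, rfl⟩
        obtain ⟨μ, hμ, hlap⟩ :=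
          h.exists_laplacian_comp_symm_eq hE b hchart (hΩ hyΩ) (hf2 y hy)
        rw [e.right_inv hyt, hf.harmonic _ hyΩ, mul_zero] at hlap
        exact hlap
    have hF1 : ContDiffOn ℝ 1 F (closedBall 0 ρ) := by
      rw [← contMDiffOn_iff_contDiffOn]
      refine hf.contMDiffOn_closure.comp
        ((h.contMDiffOn_symm.mono h.closedBall_subset).of_le one_le_two) ?_
      rw [h.closure_eq]
      exact subset_preimage_image _ _
    have hne : ∃ z ∈ ball (0 : ℂ) ρ, F z ≠ 0 := by
      obtain ⟨x, hx, hfx⟩ := hf.ne_zero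
      rw [h.eq_image_ball] at hx
      obtain ⟨z, hz, rfl⟩ := hx
      exact ⟨z, hz, hfx⟩
    have hbound : ∀ z : ℂ, ‖z‖ = ρ →
        fderivWithin ℝ F (closedBall 0 ρ) z z = (ν * (ρ * s)) * F z := by
      intro z hz
      have h1 := hf.boundary _ (hfr z hz) _ ((h.isOutwardUnitNormal_iff hE hz).2 rfl)
      have h2 := h.mvfderivWithin_smul_paramDeriv (f := f) (hbd z hz)
        ((hf.contMDiffOn_closure _ (frontier_subset_closure (hfr z hz))).mdifferentiableWithinAt
          one_ne_zero) (ρ * s)⁻¹ z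
      have h3 := h2.symm.trans h1
      rw [inv_mul_eq_iff_eq_mul₀ (by positivity)] at h3
      rw [h3, hF, Function.comp_apply]
      ring
    have := one_le_of_radial_derivative_eq hρ hF1 hharm hbound hne
      (mul_ne_zero hν (by positivity))
    rwa [div_le_iff₀ (by positivity)]

end IsConformalDisc

end Eigenvalue

/-! ### Conformal pullback metrics -/

section Models

/-- For the metrics induced by a map `j` into an inner product space, conformality of `φ` can be
read off from the derivative of `j ∘ φ`, a map between normed spaces. -/
theorem conformalPullback_isConformalAt {E : Type*} [NormedAddCommGroup E] [InnerProductSpace ℝ E]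
    [FiniteDimensional ℝ E] {M : Type*} [TopologicalSpace M] [ChartedSpace E M]
    {F : Type*} [NormedAddCommGroup F] [InnerProductSpace ℝ F]
    {j : M → F} {a : M → ℝ} {ha : ∀ x, 0 < a x}
    {hj : ∀ x, Function.Injective (mvfderiv 𝓘(ℝ, E) j x)}
    {V : Type*} [NormedAddCommGroup V] [InnerProductSpace ℝ V] {φ : V → M} {m : ℝ} {z : V}
    {D : V →L[ℝ] F}
    (hjd : MDifferentiableAt 𝓘(ℝ, E) 𝓘(ℝ, F) j (φ z))
    (hφ : MDifferentiableAt 𝓘(ℝ, V) 𝓘(ℝ, E) φ z) (hD : HasFDerivAt (j ∘ φ) D z)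
    (h : ∀ v w, a (φ z) * inner ℝ (D v) (D w) = m * inner ℝ v w) :
    IsConformalAt (conformalPullback j a ha hj) φ m z := by
  intro v w
  let J : E →L[ℝ] F := mvfderiv 𝓘(ℝ, E) j (φ z)
  have h1 := HasMFDerivAt.comp z hjd.hasMFDerivAt hφ.hasMFDerivAt
  have h2 : HasFDerivAt (j ∘ φ) (J.comp (paramDeriv φ z)) z := hasMFDerivAt_iff_hasFDerivAt.1 h1
  rw [hD.unique h2] at h
  exact h v w

theorem contMDiffOn_chartAt_trans {E M : Type*} [NormedAddCommGroup E] [NormedSpace ℝ E]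
    [TopologicalSpace M] [ChartedSpace E M] [IsManifold 𝓘(ℝ, E) 2 M] (p : M)
    {k : OpenPartialHomeomorph E ℂ} (hk : ContDiffOn ℝ 2 k k.source) :
    ContMDiffOn 𝓘(ℝ, E) 𝓘(ℝ, ℂ) 2 (chartAt E p ≫ₕ k) (chartAt E p ≫ₕ k).source := by
  refine hk.contMDiffOn.comp ((contMDiffOn_chart (n := 2) (x := p)).mono ?_) ?_
  · exact fun x hx => by simp at hx; exact hx.1
  · exact fun x hx => by simp at hx; exact hx.2

theorem contMDiffOn_chartAt_trans_symm {E M : Type*} [NormedAddCommGroup E] [NormedSpace ℝ E]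
    [TopologicalSpace M] [ChartedSpace E M] [IsManifold 𝓘(ℝ, E) 2 M] (p : M)
    {k : OpenPartialHomeomorph E ℂ} (hk : ContDiffOn ℝ 2 k.symm k.target) :
    ContMDiffOn 𝓘(ℝ, ℂ) 𝓘(ℝ, E) 2 (chartAt E p ≫ₕ k).symm (chartAt E p ≫ₕ k).target := by
  refine (contMDiffOn_chart_symm (n := 2) (x := p)).comp (hk.contMDiffOn.mono ?_) ?_
  · exact fun x hx => by simp at hx; exact hx.1
  · exact fun x hx => by simp at hx; exact hx.2

end Models

/-! ### The hyperbolic plane -/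

section Hyperbolic

open ComplexConjugate

theorem sub_conj_ne_zero (p : ℍ) {x : ℂ} (hx : 0 < x.im) : x - conj (p : ℂ) ≠ 0 := by
  intro h
  have := congrArg Complex.im h
  simp at this
  linarith [p.im_pos]

theorem one_sub_ne_zero_of_mem_ball {w : ℂ} (hw : w ∈ ball (0 : ℂ) 1) : 1 - w ≠ 0 := by
  rw [sub_ne_zero]
  rintro rfl
  simp at hw

theorem im_cayley_symm (p w : ℂ) :
    ((p - conj p * w) / (1 - w)).im = p.im * (1 - ‖w‖ ^ 2) / ‖1 - w‖ ^ 2 := by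
  rw [Complex.div_im, Complex.sq_norm, Complex.sq_norm, Complex.normSq_apply w]
  simp
  ring

theorem norm_cayley_lt_one (p : ℍ) {x : ℂ} (hx : 0 < x.im) :
    ‖(x - p) / (x - conj (p : ℂ))‖ < 1 := by
  rw [norm_div, div_lt_one (norm_pos_iff.2 (sub_conj_ne_zero p hx))]
  refine lt_of_pow_lt_pow_left₀ 2 (norm_nonneg _) ?_
  rw [Complex.sq_norm, Complex.sq_norm, Complex.normSq_apply, Complex.normSq_apply]
  simp
  nlinarith [mul_pos hx p.im_pos]

/-- The Cayley transform of the upper half-plane onto the unit disc that maps `p` to `0`. -/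
noncomputable def cayley (p : ℍ) : OpenPartialHomeomorph ℂ ℂ where
  toFun x := (x - p) / (x - conj (p : ℂ))
  invFun w := (p - conj (p : ℂ) * w) / (1 - w)
  source := {x | 0 < x.im}
  target := ball 0 1
  map_source' x hx := by
    rw [mem_ball_zero_iff]
    exact norm_cayley_lt_one p hx
  map_target' w hw := by
    change 0 < Complex.im _
    have h1 : 0 < ‖1 - w‖ := norm_pos_iff.2 (one_sub_ne_zero_of_mem_ball hw)
    have h2 : ‖w‖ < 1 := by simpa using hw
    have h3 : 0 < 1 - ‖w‖ ^ 2 := by nlinarith [norm_nonneg w]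
    have h4 : 0 < (p : ℂ).im := p.im_pos
    rw [im_cayley_symm]
    positivity
  left_inv' x hx := by
    have h1 := sub_conj_ne_zero p hx
    have h2 := sub_conj_ne_zero p p.im_pos
    have h3 : 1 - (x - p) / (x - conj (p : ℂ)) = (p - conj (p : ℂ)) / (x - conj (p : ℂ)) := by
      field_simp; ring
    rw [h3]
    field_simp
    ring
  right_inv' w hw := by
    have h1 := one_sub_ne_zero_of_mem_ball hw
    have h2 := sub_conj_ne_zero p p.im_pos
    have h3 : (p - conj (p : ℂ) * w) / (1 - w) - conj (p : ℂ) = (p - conj (p : ℂ)) / (1 - w) := by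
      field_simp; ring
    rw [h3]
    field_simp
    ring
  open_source := isOpen_lt continuous_const Complex.continuous_im
  open_target := isOpen_ball
  continuousOn_toFun := (continuousOn_id.sub continuousOn_const).div
    (continuousOn_id.sub continuousOn_const) fun x hx => sub_conj_ne_zero p hx
  continuousOn_invFun := (continuousOn_const.sub (continuousOn_const.mul continuousOn_id)).div
    (continuousOn_const.sub continuousOn_id) fun w hw => one_sub_ne_zero_of_mem_ball hw

theorem contDiffOn_cayley (p : ℍ) : ContDiffOn ℝ 2 (cayley p) (cayley p).source :=
  ((contDiffOn_id.sub contDiffOn_const).div (contDiffOn_id.sub contDiffOn_const)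
    fun _ hx => sub_conj_ne_zero p hx : ContDiffOn ℂ 2 _ _).restrict_scalars ℝ

theorem contDiffOn_cayley_symm (p : ℍ) : ContDiffOn ℝ 2 (cayley p).symm (cayley p).target :=
  ((contDiffOn_const.sub (contDiffOn_const.mul contDiffOn_id)).div
    (contDiffOn_const.sub contDiffOn_id)
    fun _ hw => one_sub_ne_zero_of_mem_ball hw : ContDiffOn ℂ 2 _ _).restrict_scalars ℝ

theorem hasFDerivAt_cayley_symm (p : ℍ) {w : ℂ} (hw : w ∈ ball (0 : ℂ) 1) :
    HasFDerivAt (cayley p).symm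
      (((p - conj (p : ℂ)) / (1 - w) ^ 2) • (1 : ℂ →L[ℝ] ℂ)) w := by
  apply HasDerivAt.complexToReal_fderiv
  have h1 := one_sub_ne_zero_of_mem_ball hw
  have := (((hasDerivAt_id w).const_mul (conj (p : ℂ))).const_sub (p : ℂ)).div
    ((hasDerivAt_id w).const_sub 1) h1
  convert! this using 1
  simp
  field_simp
  ring

theorem chartAt_upperHalfPlane_target (p : ℍ) : (chartAt ℂ p).target = {x : ℂ | 0 < x.im} := by
  ext x
  constructor
  · intro hx
    rw [← (chartAt ℂ p).right_inv hx]
    exact ((chartAt ℂ p).symm x).im_pos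
  · intro hx
    exact (chartAt ℂ p).map_source (x := ⟨x, hx⟩) trivial

theorem coe_chartAt_upperHalfPlane_symm (p : ℍ) {x : ℂ} (hx : 0 < x.im) :
    (((chartAt ℂ p).symm x : ℍ) : ℂ) = x :=
  (chartAt ℂ p).right_inv ((chartAt_upperHalfPlane_target p).symm ▸ hx : x ∈ (chartAt ℂ p).target)

instance isManifold_upperHalfPlane_real : IsManifold 𝓘(ℝ, ℂ) 2 ℍ :=
  UpperHalfPlane.isOpenEmbedding_coe.isManifold_singleton

theorem mdifferentiable_coe_upperHalfPlane :
    MDifferentiable 𝓘(ℝ, ℂ) 𝓘(ℝ, ℂ) (fun z : ℍ => (z : ℂ)) :=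
  ContMDiff.mdifferentiable (n := 2) (fun _ => contMDiffAt_extChartAt) two_ne_zero

theorem hyperbolicMetric_isConformalAt_chartAt_symm (p : ℍ) {y : ℂ} (hy : 0 < y.im) :
    IsConformalAt hyperbolicMetric (chartAt ℂ p).symm (y.im ^ 2)⁻¹ y := by
  have ht : (chartAt ℂ p).target ∈ 𝓝 y := (chartAt ℂ p).open_target.mem_nhds
    ((chartAt_upperHalfPlane_target p).symm ▸ hy)
  have hC := ((contMDiffOn_chart_symm (I := 𝓘(ℝ, ℂ)) (n := 2) (x := p)).contMDiffAt ht)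
  refine conformalPullback_isConformalAt (D := ContinuousLinearMap.id ℝ ℂ)
    (mdifferentiable_coe_upperHalfPlane _) (hC.mdifferentiableAt two_ne_zero) ?_ ?_
  · refine (hasFDerivAt_id y).congr_of_eventuallyEq ?_
    filter_upwards [ht] with x hx
    rw [chartAt_upperHalfPlane_target] at hx
    exact coe_chartAt_upperHalfPlane_symm p hx
  · intro v w
    rw [← UpperHalfPlane.coe_im, coe_chartAt_upperHalfPlane_symm p hy]
    simp

theorem cayley_target (p : ℍ) : (chartAt ℂ p ≫ₕ cayley p).target = ball 0 1 := by
  rw [OpenPartialHomeomorph.trans_target, chartAt_upperHalfPlane_target]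
  exact inter_eq_left.2 fun w hw => (cayley p).map_target hw

theorem hyperbolicMetric_isConformalAt_cayley (p : ℍ) {z : ℂ} (hz : z ∈ ball (0 : ℂ) 1) :
    IsConformalAt hyperbolicMetric (chartAt ℂ p ≫ₕ cayley p).symm ((2 / (1 - ‖z‖ ^ 2)) ^ 2) z := by
  have him : ∀ w ∈ ball (0 : ℂ) 1, 0 < ((cayley p).symm w).im := fun w hw =>
    (cayley p).map_target hw
  have hcoe : ∀ w ∈ ball (0 : ℂ) 1,
      (((chartAt ℂ p ≫ₕ cayley p).symm w : ℍ) : ℂ) = (cayley p).symm w := fun w hw =>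
    coe_chartAt_upperHalfPlane_symm p (him w hw)
  have ht := cayley_target p
  have hC := (contMDiffOn_chartAt_trans_symm p (contDiffOn_cayley_symm p)).contMDiffAt
    (ht ▸ isOpen_ball.mem_nhds hz)
  refine conformalPullback_isConformalAt
    (mdifferentiable_coe_upperHalfPlane _) (hC.mdifferentiableAt two_ne_zero)
    ((hasFDerivAt_cayley_symm p hz).congr_of_eventuallyEq ?_) ?_
  · filter_upwards [isOpen_ball.mem_nhds hz] with w hw using hcoe w hw
  · intro v w
    rw [← UpperHalfPlane.coe_im, hcoe z hz]
    have h1 : 0 < ‖1 - z‖ := norm_pos_iff.2 (one_sub_ne_zero_of_mem_ball hz)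
    have h2 : ‖z‖ < 1 := by simpa using hz
    have h3 : 0 < 1 - ‖z‖ ^ 2 := by nlinarith [norm_nonneg z]
    have h4 : 0 < (p : ℂ).im := p.im_pos
    have h5 : ((cayley p).symm z).im = (p : ℂ).im * (1 - ‖z‖ ^ 2) / ‖1 - z‖ ^ 2 :=
      im_cayley_symm p z
    have h6 : ‖((p : ℂ) - conj (p : ℂ)) / (1 - z) ^ 2‖ = 2 * (p : ℂ).im / ‖1 - z‖ ^ 2 := by
      rw [norm_div, norm_pow, Complex.sub_conj, norm_mul, Complex.norm_I, mul_one,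
        Complex.norm_real, Real.norm_of_nonneg (by positivity)]
    have h7 : ∀ d : ℂ, inner ℝ (d * v) (d * w) = ‖d‖ ^ 2 * inner ℝ v w := by
      intro d
      rw [Complex.inner, Complex.inner, Complex.sq_norm, ← Complex.re_ofReal_mul,
        Complex.normSq_eq_conj_mul_self, map_mul]
      ring_nf
    simp only [smul_apply, one_apply_eq_self, smul_eq_mul]
    rw [h7, h6, h5]
    field_simp

theorem tanh_lt_tanh_iff {a b : ℝ} : Real.tanh a < Real.tanh b ↔ a < b := by
  have h : ∀ a, Real.tanh a ∈ Ioo (-1 : ℝ) 1 := fun a =>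
    ⟨Real.neg_one_lt_tanh a, Real.tanh_lt_one a⟩
  rw [← Real.artanh_lt_artanh_iff (h a) (h b), Real.artanh_tanh, Real.artanh_tanh]

/-- The hyperbolic distance `d` from `p` to `x` satisfies `tanh (d / 2) = |x - p| / |x - conj p|`,
which is the modulus of the Cayley transform of `x`. -/
theorem isConformalDisc_upperHalfPlane (p : ℍ) {R : ℝ} (hR : 0 < R) :
    IsConformalDisc hyperbolicMetric (chartAt ℂ p ≫ₕ cayley p) (Real.tanh (R / 2))
      (2 / (1 - Real.tanh (R / 2) ^ 2)) (geodesicBall (fun z w : ℍ => dist z w) p R) := by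
  have h0 : 0 < Real.tanh (R / 2) := by
    rw [← Real.tanh_zero, tanh_lt_tanh_iff]; positivity
  have h1 := Real.tanh_lt_one (R / 2)
  have ht : (chartAt ℂ p ≫ₕ cayley p).target = ball 0 1 := cayley_target p
  constructor
  · exact h0
  · have : 0 < 1 - Real.tanh (R / 2) ^ 2 := by nlinarith
    positivity
  · exact contMDiffOn_chartAt_trans p (contDiffOn_cayley p)
  · exact contMDiffOn_chartAt_trans_symm p (contDiffOn_cayley_symm p)
  · intro z hz
    rw [ht] at hz
    have : ‖z‖ < 1 := by simpa using hz
    have : 0 < 1 - ‖z‖ ^ 2 := by nlinarith [norm_nonneg z]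
    exact ⟨_, by positivity, hyperbolicMetric_isConformalAt_cayley p hz⟩
  · intro z hz
    rw [← hz]
    exact hyperbolicMetric_isConformalAt_cayley p (by simpa [hz] using h1)
  · rw [ht]
    exact closedBall_subset_ball h1
  · intro x
    have h2 : ‖(chartAt ℂ p ≫ₕ cayley p) x‖ = Real.tanh (dist x p / 2) := by
      rw [UpperHalfPlane.tanh_half_dist, dist_eq_norm, dist_eq_norm, ← norm_div]
      rfl
    have h3 : x ∈ (chartAt ℂ p ≫ₕ cayley p).source := ⟨trivial, x.im_pos⟩
    rw [h2, tanh_lt_tanh_iff, geodesicBall, mem_ofPred_eq, dist_comm]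
    constructor
    · exact fun h => ⟨h3, by linarith⟩
    · exact fun h => by linarith [h.2]

theorem isFirstNonzeroSteklovEigenvalue_upperHalfPlane (p : ℍ) {R : ℝ} (hR : 0 < R) :
    IsFirstNonzeroSteklovEigenvalue hyperbolicMetric Complex.basisOneI
      (geodesicBall (fun z w : ℍ => dist z w) p R) (1 / Real.sinh R) := by
  have h := (isConformalDisc_upperHalfPlane p hR).isFirstNonzeroSteklovEigenvalue (by simp)
    Complex.orthonormalBasisOneI (fun x y hy => by
      rw [chartAt_upperHalfPlane_target] at hy
      exact ⟨_, inv_pos.2 (pow_pos hy 2), hyperbolicMetric_isConformalAt_chartAt_symm x hy⟩)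
  rw [Complex.toBasis_orthonormalBasisOneI] at h
  convert! h using 2
  have h1 : Real.cosh (R / 2) ≠ 0 := (Real.cosh_pos _).ne'
  have h2 := Real.cosh_sq (R / 2)
  have h3 : 1 - Real.tanh (R / 2) ^ 2 = (Real.cosh (R / 2) ^ 2)⁻¹ := by
    rw [Real.tanh_eq_sinh_div_cosh]
    field_simp
    linarith
  rw [h3, show R = 2 * (R / 2) by ring, Real.sinh_two_mul, Real.tanh_eq_sinh_div_cosh]
  field_simp

end Hyperbolic

/-! ### The sphere -/

section Sphere

/-- The inverse stereographic projection from a unit vector `v`, precomposed with an isometry `T`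
onto a subspace orthogonal to `v`, is conformal. -/
theorem exists_hasFDerivAt_stereoInv {V W : Type*} [NormedAddCommGroup V] [InnerProductSpace ℝ V]
    [NormedAddCommGroup W] [InnerProductSpace ℝ W] (T : V →ₗᵢ[ℝ] W) {v : W} (hv : ‖v‖ = 1)
    (hT : ∀ y, inner ℝ (T y) v = 0) (y : V) :
    ∃ D : V →L[ℝ] W,
      HasFDerivAt (fun y => (‖y‖ ^ 2 + 4)⁻¹ • ((4 : ℝ) • T y + (‖y‖ ^ 2 - 4) • v)) D y ∧
      ∀ a b, inner ℝ (D a) (D b) = (4 / (‖y‖ ^ 2 + 4)) ^ 2 * inner ℝ a b := by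
  have hq : ‖y‖ ^ 2 + 4 ≠ 0 := by positivity
  have h1 : HasFDerivAt (fun y : V => ‖y‖ ^ 2) (2 • innerSL ℝ y) y :=
    (hasStrictFDerivAt_norm_sq y).hasFDerivAt
  have h2 := (hasDerivAt_inv hq).comp_hasFDerivAt y (h1.add_const 4)
  have h3 : HasFDerivAt (fun y => T y) T.toContinuousLinearMap y :=
    T.toContinuousLinearMap.hasFDerivAt
  have h4 := h2.smul ((h3.const_smul (4 : ℝ)).add ((h1.sub_const 4).smul_const v))
  refine ⟨_, h4, fun a b => ?_⟩
  have e1 : ∀ a b, inner ℝ (T a) (T b) = inner ℝ a b := T.inner_map_map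
  have e2 : ∀ y, inner ℝ v (T y) = 0 := fun y => by rw [real_inner_comm, hT]
  have e3 : inner ℝ v v = (1 : ℝ) := by rw [real_inner_self_eq_norm_sq, hv]; norm_num
  have e4 : inner ℝ y y = ‖y‖ ^ 2 := real_inner_self_eq_norm_sq y
  simp [inner_add_left, inner_add_right, inner_smul_left, inner_smul_right, hT, e2, e1, hv]
  rw [real_inner_comm y a]
  field_simp
  ring

/-- A great circle is a geodesic, and distances on the sphere do not exceed `π`. -/
theorem injectivityRadius_sphereDist_le :
    injectivityRadius sphereDist ≤ ENNReal.ofReal Real.pi := by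
  let γ : ℝ → S2 := fun t => ⟨!₂[Real.cos t, Real.sin t, 0], by
    simp [EuclideanSpace.norm_eq, Fin.sum_univ_three]⟩
  have hγ : IsUnitSpeedGeodesic sphereDist γ := by
    intro t
    refine ⟨1, one_pos, fun s hs s' hs' => ?_⟩
    have hn : ∀ t, ‖(γ t : EuclideanSpace ℝ (Fin 3))‖ = 1 := fun t => norm_eq_of_mem_sphere (γ t)
    rw [sphereDist, InnerProductGeometry.angle, hn, hn, mul_one, div_one]
    have : inner ℝ (γ s : EuclideanSpace ℝ (Fin 3)) (γ s' : EuclideanSpace ℝ (Fin 3)) =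
        Real.cos |s - s'| := by
      rw [Real.cos_abs, Real.cos_sub]
      simp [γ, PiLp.inner_apply, Fin.sum_univ_three]
      ring
    rw [this, Real.arccos_cos (abs_nonneg _)]
    have : |s - s'| ≤ 2 := by
      rw [abs_le]; constructor <;> linarith [hs.1, hs.2, hs'.1, hs'.2]
    linarith [Real.pi_gt_three]
  refine (iInf₂_le γ hγ).trans (iSup₂_le fun t ht => ENNReal.ofReal_le_ofReal ?_)
  rw [← ht]
  exact InnerProductGeometry.angle_le_pi _ _

/-- The chart of the sphere at `p` is the stereographic projection from `-p`, in coordinates of the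
orthogonal complement of `p`; in Mathlib's normalization it is the identity to first order at `p`,
whence the constant `4`. -/
theorem exists_coe_chartAt_sphere_symm (p : S2) :
    ∃ T : EuclideanSpace ℝ (Fin 2) →ₗᵢ[ℝ] EuclideanSpace ℝ (Fin 3),
      (∀ y, inner ℝ (T y) (-(p : EuclideanSpace ℝ (Fin 3))) = 0) ∧
      ∀ y, (((chartAt (EuclideanSpace ℝ (Fin 2)) p).symm y : S2) : EuclideanSpace ℝ (Fin 3)) =
        (‖y‖ ^ 2 + 4)⁻¹ • ((4 : ℝ) • T y + (‖y‖ ^ 2 - 4) • -(p : EuclideanSpace ℝ (Fin 3))) := by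
  have : Fact (Module.finrank ℝ (EuclideanSpace ℝ (Fin 3)) = 2 + 1) :=
    ⟨finrank_euclideanSpace_fin⟩
  let U := (OrthonormalBasis.fromOrthogonalSpanSingleton (𝕜 := ℝ) 2
    (ne_zero_of_mem_unit_sphere (-p))).repr
  refine ⟨(ℝ ∙ ((-p : S2) : EuclideanSpace ℝ (Fin 3)))ᗮ.subtypeₗᵢ.comp U.symm.toLinearIsometry,
    fun y => ?_, fun y => ?_⟩
  · exact Submodule.mem_orthogonal_singleton_iff_inner_left.1 (U.symm y).2
  · have h := stereographic'_symm_apply (-p) y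
    have hn : ‖((U.symm y : (ℝ ∙ ((-p : S2) : EuclideanSpace ℝ (Fin 3)))ᗮ) :
      EuclideanSpace ℝ (Fin 3))‖ = ‖y‖ := U.symm.norm_map y
    rw [smul_add, ← hn]
    exact h

theorem chartAt_sphere_source (p : S2) :
    (chartAt (EuclideanSpace ℝ (Fin 2)) p).source = {-p}ᶜ := by
  have : Fact (Module.finrank ℝ (EuclideanSpace ℝ (Fin 3)) = 2 + 1) :=
    ⟨finrank_euclideanSpace_fin⟩
  exact stereographic'_source (-p)

theorem chartAt_sphere_target (p : S2) :
    (chartAt (EuclideanSpace ℝ (Fin 2)) p).target = univ := by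
  have : Fact (Module.finrank ℝ (EuclideanSpace ℝ (Fin 3)) = 2 + 1) :=
    ⟨finrank_euclideanSpace_fin⟩
  exact stereographic'_target (-p)

instance isManifold_S2 : IsManifold 𝓘(ℝ, EuclideanSpace ℝ (Fin 2)) 2 S2 :=
  IsManifold.of_le (n := ω) le_top

theorem sphereMetric_isConformalAt (p : S2) {V : Type*} [NormedAddCommGroup V]
    [InnerProductSpace ℝ V] (L : V →ₗᵢ[ℝ] EuclideanSpace ℝ (Fin 2)) (y : V) :
    IsConformalAt sphereMetric ((chartAt (EuclideanSpace ℝ (Fin 2)) p).symm ∘ L)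
      ((4 / (‖y‖ ^ 2 + 4)) ^ 2) y := by
  obtain ⟨T, hT, hc⟩ := exists_coe_chartAt_sphere_symm p
  obtain ⟨D, hD, hDD⟩ := exists_hasFDerivAt_stereoInv (T.comp L)
    (v := -(p : EuclideanSpace ℝ (Fin 3))) (by simp) (fun y => hT (L y)) y
  have hL : MDifferentiableAt 𝓘(ℝ, V) 𝓘(ℝ, EuclideanSpace ℝ (Fin 2)) L y :=
    (L.contDiff (n := 1)).contMDiff.mdifferentiable one_ne_zero y
  have hC := (contMDiffOn_chart_symm (I := 𝓘(ℝ, EuclideanSpace ℝ (Fin 2))) (n := 2)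
    (x := p)).contMDiffAt (x := L y) (by rw [chartAt_sphere_target]; exact univ_mem)
  refine conformalPullback_isConformalAt ?_ ((hC.mdifferentiableAt two_ne_zero).comp y hL)
    (hD.congr_of_eventuallyEq (Eventually.of_forall fun y => ?_)) fun v w => ?_
  · have : Fact (Module.finrank ℝ (EuclideanSpace ℝ (Fin 3)) = 2 + 1) :=
      ⟨finrank_euclideanSpace_fin⟩
    exact (contMDiff_coe_sphere (m := 1)).mdifferentiable one_ne_zero _
  · simp only [Function.comp_apply, hc, L.norm_map]
    rfl
  · rw [one_mul, hDD]

/-- Stereographic projection from the antipode of `p`, as a map to the complex plane. -/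
noncomputable def stereographicComplex (p : S2) : OpenPartialHomeomorph S2 ℂ :=
  chartAt (EuclideanSpace ℝ (Fin 2)) p ≫ₕ
    Complex.orthonormalBasisOneI.repr.symm.toHomeomorph.toOpenPartialHomeomorph

theorem stereographicComplex_source (p : S2) : (stereographicComplex p).source = {-p}ᶜ := by
  simp [stereographicComplex, chartAt_sphere_source]

theorem stereographicComplex_target (p : S2) : (stereographicComplex p).target = univ := by
  simp [stereographicComplex, chartAt_sphere_target]

theorem inner_stereographicComplex_symm (p : S2) (z : ℂ) :
    inner ℝ (p : EuclideanSpace ℝ (Fin 3)) ((stereographicComplex p).symm z : S2) =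
      (4 - ‖z‖ ^ 2) / (‖z‖ ^ 2 + 4) := by
  obtain ⟨T, hT, hc⟩ := exists_coe_chartAt_sphere_symm p
  have h1 := hc (Complex.orthonormalBasisOneI.repr z)
  rw [LinearIsometryEquiv.norm_map] at h1
  have h2 : ∀ y, inner ℝ (p : EuclideanSpace ℝ (Fin 3)) (T y) = 0 := fun y => by
    have := hT y
    rw [inner_neg_right, neg_eq_zero] at this
    rw [real_inner_comm, this]
  have h3 : ((stereographicComplex p).symm z : EuclideanSpace ℝ (Fin 3)) = _ := h1
  rw [h3, inner_smul_right, inner_add_right, inner_smul_right, inner_smul_right, h2,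
    inner_neg_right, real_inner_self_eq_norm_sq, norm_eq_of_mem_sphere]
  ring

theorem sphereDist_stereographicComplex_symm_lt_iff (p : S2) {R : ℝ} (hR : 0 < R)
    (hπ : R < Real.pi) (z : ℂ) :
    sphereDist p ((stereographicComplex p).symm z) < R ↔ ‖z‖ < 2 * Real.tan (R / 2) := by
  have hc : 0 < Real.cos (R / 2) := Real.cos_pos_of_mem_Ioo ⟨by linarith, by linarith⟩
  have ht : 0 < Real.tan (R / 2) := Real.tan_pos_of_pos_of_lt_pi_div_two (by linarith) (by linarith)
  have h1 : sphereDist p ((stereographicComplex p).symm z) < R ↔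
      Real.cos R < (4 - ‖z‖ ^ 2) / (‖z‖ ^ 2 + 4) := by
    rw [← inner_stereographicComplex_symm p z]
    have := Real.strictAntiOn_cos.lt_iff_gt ⟨hR.le, hπ.le⟩
      ⟨InnerProductGeometry.angle_nonneg (p : EuclideanSpace ℝ (Fin 3))
        ((stereographicComplex p).symm z : S2), InnerProductGeometry.angle_le_pi _ _⟩
    rw [InnerProductGeometry.cos_angle, norm_eq_of_mem_sphere, norm_eq_of_mem_sphere, mul_one,
      div_one] at this
    exact this.symm
  have h2 : Real.cos R = 2 * Real.cos (R / 2) ^ 2 - 1 := by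
    rw [← Real.cos_two_mul]; congr 1; ring
  have h3 : Real.sin (R / 2) ^ 2 = 1 - Real.cos (R / 2) ^ 2 := Real.sin_sq _
  rw [h1, lt_div_iff₀ (by positivity), ← sq_lt_sq₀ (norm_nonneg z) (by positivity), h2,
    Real.tan_eq_sin_div_cos, mul_pow, div_pow, h3, mul_div_assoc', lt_div_iff₀ (by positivity)]
  constructor <;> intro h <;> nlinarith

theorem isConformalDisc_sphere (p : S2) {R : ℝ} (hR : 0 < R) (hπ : R < Real.pi) :
    IsConformalDisc sphereMetric (stereographicComplex p) (2 * Real.tan (R / 2))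
      (Real.cos (R / 2) ^ 2) (geodesicBall sphereDist p R) := by
  have hc : 0 < Real.cos (R / 2) := Real.cos_pos_of_mem_Ioo ⟨by linarith, by linarith⟩
  have ht : 0 < Real.tan (R / 2) := Real.tan_pos_of_pos_of_lt_pi_div_two (by linarith) (by linarith)
  constructor
  · positivity
  · positivity
  · exact contMDiffOn_chartAt_trans p
      Complex.orthonormalBasisOneI.repr.symm.toLinearIsometry.contDiff.contDiffOn
  · exact contMDiffOn_chartAt_trans_symm p
      Complex.orthonormalBasisOneI.repr.toLinearIsometry.contDiff.contDiffOn
  · exact fun z _ => ⟨_, by positivity,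
      sphereMetric_isConformalAt p Complex.orthonormalBasisOneI.repr.toLinearIsometry z⟩
  · intro z hz
    have h := sphereMetric_isConformalAt p Complex.orthonormalBasisOneI.repr.toLinearIsometry z
    convert! h using 2
    have h3 : Real.sin (R / 2) ^ 2 = 1 - Real.cos (R / 2) ^ 2 := Real.sin_sq _
    rw [hz, mul_pow, Real.tan_eq_sin_div_cos, div_pow, h3]
    field_simp
    ring
  · rw [stereographicComplex_target]
    exact subset_univ _
  · intro x
    by_cases hx : x = -p
    -- The antipode is outside the coordinate domain, and at distance `π > R` from `p`.
    · subst hx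
      simp only [stereographicComplex_source, mem_compl_iff, mem_singleton_iff, not_true_eq_false,
        false_and, iff_false]
      rw [geodesicBall, mem_ofPred_eq, not_lt, sphereDist]
      change R ≤ InnerProductGeometry.angle (p : EuclideanSpace ℝ (Fin 3)) (-p)
      rw [InnerProductGeometry.angle_self_neg_of_nonzero (ne_zero_of_mem_unit_sphere p)]
      exact hπ.le
    · have hx' : x ∈ (stereographicComplex p).source := by
        rw [stereographicComplex_source]; exact hx
      rw [and_iff_right hx', ← sphereDist_stereographicComplex_symm_lt_iff p hR hπ,
        (stereographicComplex p).left_inv hx']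
      rfl

theorem isFirstNonzeroSteklovEigenvalue_sphere (p : S2) {R : ℝ} (hR : 0 < R) (hπ : R < Real.pi) :
    IsFirstNonzeroSteklovEigenvalue sphereMetric (EuclideanSpace.basisFun (Fin 2) ℝ).toBasis
      (geodesicBall sphereDist p R) (1 / Real.sin R) := by
  have h := (isConformalDisc_sphere p hR hπ).isFirstNonzeroSteklovEigenvalue (by simp)
    (EuclideanSpace.basisFun (Fin 2) ℝ) (fun x y _ => ⟨_, by positivity,
      sphereMetric_isConformalAt x LinearIsometry.id y⟩)
  convert! h using 2
  have hc : 0 < Real.cos (R / 2) := Real.cos_pos_of_mem_Ioo ⟨by linarith, by linarith⟩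
  rw [Real.tan_eq_sin_div_cos]
  nth_rw 1 [show R = 2 * (R / 2) by ring]
  rw [Real.sin_two_mul]
  field_simp

end Sphere

end Steklov

theorem corollary1 :
    (∀ (p : Steklov.S2) (R : ℝ), 0 < R →
      ENNReal.ofReal R < Steklov.injectivityRadius Steklov.sphereDist →
      Steklov.IsFirstNonzeroSteklovEigenvalue Steklov.sphereMetric
        (EuclideanSpace.basisFun (Fin 2) ℝ).toBasis
        (Steklov.geodesicBall Steklov.sphereDist p R) (1 / Real.sin R)) ∧
    (∀ (p : ℍ) (R : ℝ), 0 < R →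
      ENNReal.ofReal R < Steklov.injectivityRadius (fun z w : ℍ => dist z w) →
      Steklov.IsFirstNonzeroSteklovEigenvalue Steklov.hyperbolicMetric
        Complex.basisOneI
        (Steklov.geodesicBall (fun z w : ℍ => dist z w) p R) (1 / Real.sinh R)) := by
  refine ⟨fun p R hR hinj => ?_, fun p R hR _ =>
    Steklov.isFirstNonzeroSteklovEigenvalue_upperHalfPlane p hR⟩
  have h := hinj.trans_le Steklov.injectivityRadius_sphereDist_le
  rw [ENNReal.ofReal_lt_ofReal_iff Real.pi_pos] at h
  exact Steklov.isFirstNonzeroSteklovEigenvalue_sphere p hR h
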